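/- Conventions. Modules are left modules. For an artin algebra (more generally, a left artinian ring) $\Lambda$ let $\widetilde Q_\Lambda$ be the direct sum of representatives of the isomorphism classes of all indecomposable projective-injective finitely generated $\Lambda$-modules, and let $\mathcal C_\Lambda=\operatorname{Gen}(\widetilde Q_\Lambda)\cap\operatorname{Cogen}(\widetilde Q_\Lambda)$ be the full subcategory of the finitely generated $\Lambda$-modules $X$ for which there are an epimorphism $\widetilde Q_\Lambda^{\,m}\to X$ and a monomorphism $X\to\widetilde Q_\Lambda^{\,m'}$ for some $m,m'\ge 0$. A tilting $\Lambda$-module is a finitely generated basic $\Lambda$-module $T$ (a finite direct sum of pairwise non-isomorphic indecomposable modules) such that $\operatorname{pd}T\le 1$, $\operatorname{Ext}^1_\Lambda(T,T)=0$, and there is an exact sequence $0\to\Lambda\to T_0\to T_1\to 0$ with $T_0,T_1\in\operatorname{add}T$. An Auslander algebra is an artin algebra $A$ with $\operatorname{gl.dim}A\le 2\le\operatorname{dom.dim}A$, where $\operatorname{dom.dim}A$ is the supremum of all $k$ such that the terms $I^0,\dots,I^{k-1}$ of a minimal injective resolution $0\to A\to I^0\to I^1\to\cdots$ of the left module $A$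 are projective. **Theorem.** Let $A$ be an Auslander algebra and let $E=I_1\oplus\dots\oplus I_r$, where $I_1,\dots,I_r$ are finitely generated indecomposable injective $A$-modules such that (i) $K_i:=\operatorname{End}_A(I_i)$ is a division ring for every $i$; (ii) $\operatorname{Hom}_A(I_i,I_j)=0$ for all $i\ne j$; (iii) $\operatorname{Hom}_A(E,Q)=0$ for every finitely generated projective-injective $A$-module $Q$. Let $R=\operatorname{End}_A(E)^{op}$, regard $E$ as an $A$-$R$-bimodule, and let $$A[E]=\begin{pmatrix}R&0\\ E&A\end{pmatrix}$$ be the triangular matrix algebra. A triple $(W,V,f)$ of an $R$-module $W$, an $A$-module $V$ and an $A$-homomorphism $f:E\otimes_RW\to V$ is identified with the $A[E]$-module $W\oplus V$ on which $\begin{pmatrix}\rho&0\\ e&a\end{pmatrix}$ acts by $(w,v)\mapsto(\rho w,\ f(e\otimes w)+av)$. Then: 1. There is a tilting $A[E]$-module in $\mathcal C_{A[E]}$. 2. There is a tilting $A$-module in $\mathcal C_A$, and for every tilting $A$-module $T_{\mathcal C}$ in $\mathcal C_A$ the $A[E]$-module $$(0,T_{\mathcal C},0)\ \oplus\ \bigoplus_{i=1}^r\bigl(\operatorname{Hom}_A(E,I_i),\,I_i,\,\eta_i\bigr),\qquad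 \eta_i:E\otimes_R\operatorname{Hom}_A(E,I_i)\to I_i,\quad \eta_i(e\otimes f)=f(e),$$ is a tilting $A[E]$-module that lies in $\mathcal C_{A[E]}$. Here $R$ acts on $\operatorname{Hom}_A(E,I_i)$ by precomposition. 3. For every $i$, restriction to the summand $I_i$ of $E$ is a bijection $\operatorname{Hom}_A(E,I_i)\to\operatorname{End}_A(I_i)=K_i$, and $\eta_i$ is an isomorphism, so the summands in 2 are the triples $(K_i,I_i,\eta_i)$. -/

import Mathlib

open CategoryTheory
open scoped TensorProduct

universe u

set_option linter.unusedSectionVars false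

noncomputable section

section ModuleNotions

variable (Λ : Type u) [Ring Λ]

/-- The global dimension: the supremum of the projective dimensions of the finitely generated
left modules. -/
def globalDimension : WithBot ℕ∞ :=
  ⨆ (X : ModuleCat.{u} Λ) (_ : Module.Finite Λ X), projectiveDimension X

variable {Λ}

/-- An essential submodule meets every nonzero submodule. -/
def IsEssentialSubmodule {M : Type u} [AddCommGroup M] [Module Λ M] (N : Submodule Λ M) : Prop :=
  ∀ P : Submodule Λ M, N ⊓ P = ⊥ → P = ⊥

/-- An injective resolution `0 → M → I⁰ → I¹ → ⋯` is minimal if every kernel `ker (Iⁿ → Iⁿ⁺¹)`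
(which is the image of `M` for `n = 0` and the image of `Iⁿ⁻¹` for `n ≥ 1`) is essential in `Iⁿ`,
that is, if `Iⁿ` is its injective envelope. -/
def IsMinimalInjectiveResolution {M : ModuleCat.{u} Λ} (I : InjectiveResolution M) : Prop :=
  ∀ n : ℕ, IsEssentialSubmodule (LinearMap.ker (I.cocomplex.d n (n + 1)).hom)

/-- The dominant dimension of a module: the supremum of the `k` such that the terms `Iⁱ` with
`i < k` of a minimal injective resolution are projective. -/
def dominantDimension (M : ModuleCat.{u} Λ) : ℕ∞ :=
  sSup {k : ℕ∞ | ∃ I : InjectiveResolution M, IsMinimalInjectiveResolution I ∧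
    ∀ i : ℕ, (i : ℕ∞) < k → Projective (I.cocomplex.X i)}

variable (Λ) in
/-- The homological condition `gldim Λ ≤ 2 ≤ domdim Λ` that singles out the Auslander algebras
among the artin algebras. -/
def IsAuslander : Prop :=
  globalDimension Λ ≤ 2 ∧ 2 ≤ dominantDimension (ModuleCat.of Λ Λ)

/-- `X` lies in `Gen Q`: it is a quotient of some `Qᵐ`. -/
def IsGeneratedBy (Q X : ModuleCat.{u} Λ) : Prop :=
  ∃ (m : ℕ) (f : (Fin m → Q) →ₗ[Λ] X), Function.Surjective f

/-- `X` lies in `Cogen Q`: it is a submodule of some `Qᵐ`. -/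
def IsCogeneratedBy (Q X : ModuleCat.{u} Λ) : Prop :=
  ∃ (m : ℕ) (f : X →ₗ[Λ] (Fin m → Q)), Function.Injective f

/-- `X` lies in `add T`: it is a direct summand of some `Tᵐ`. -/
def IsInAdd (T X : ModuleCat.{u} Λ) : Prop :=
  ∃ (m : ℕ) (i : X →ₗ[Λ] (Fin m → T)) (p : (Fin m → T) →ₗ[Λ] X), p ∘ₗ i = LinearMap.id

/-- Finitely generated indecomposable modules that are both projective and injective. -/
structure IsIndecProjInj (Q : ModuleCat.{u} Λ) : Prop where
  finite : Module.Finite Λ Q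
  indecomposable : Indecomposable Q
  projective : Projective Q
  injective : Injective Q

/-- `Q` is the direct sum of a complete irredundant finite list of representatives of the
isomorphism classes of indecomposable projective-injective modules. -/
def IsSumOfProjInj (Q : ModuleCat.{u} Λ) : Prop :=
  ∃ (t : ℕ) (X : Fin t → ModuleCat.{u} Λ),
    (∀ i, IsIndecProjInj (X i)) ∧
    (∀ i j, Nonempty (X i ≃ₗ[Λ] X j) → i = j) ∧
    (∀ Y : ModuleCat.{u} Λ, IsIndecProjInj Y → ∃ i, Nonempty (Y ≃ₗ[Λ] X i)) ∧
    Nonempty (Q ≃ₗ[Λ] (∀ i, X i))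

/-- Membership in the subcategory `C_Λ = Gen Q̃ ∩ Cogen Q̃` of the finitely generated modules. -/
def IsInC (X : ModuleCat.{u} Λ) : Prop :=
  Module.Finite Λ X ∧
    ∃ Q : ModuleCat.{u} Λ, IsSumOfProjInj Q ∧ IsGeneratedBy Q X ∧ IsCogeneratedBy Q X

/-- A basic module: a finite direct sum of pairwise non-isomorphic indecomposable modules. -/
def IsBasicModule (T : ModuleCat.{u} Λ) : Prop :=
  ∃ (n : ℕ) (X : Fin n → ModuleCat.{u} Λ),
    (∀ i, Indecomposable (X i)) ∧
    (∀ i j, Nonempty (X i ≃ₗ[Λ] X j) → i = j) ∧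
    Nonempty (T ≃ₗ[Λ] (∀ i, X i))

/-- (Classical, basic, finitely generated) tilting modules. -/
structure IsTilting (T : ModuleCat.{u} Λ) : Prop where
  finite : Module.Finite Λ T
  basic : IsBasicModule T
  pd_le_one : HasProjectiveDimensionLE T 1
  rigid : Subsingleton (Abelian.Ext T T 1)
  coresolution : ∃ (T₀ T₁ : ModuleCat.{u} Λ) (f : Λ →ₗ[Λ] T₀) (g : T₀ →ₗ[Λ] T₁),
    IsInAdd T T₀ ∧ IsInAdd T T₁ ∧
    Function.Injective f ∧ Function.Exact f g ∧ Function.Surjective g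

end ModuleNotions

section Triangular

/-- The triangular matrix ring `[[R, 0], [M, S]]`. -/
@[ext]
structure TriangularRing (R S M : Type u) where
  r : R
  m : M
  s : S

variable (R S M : Type u) [Ring R] [Ring S] [AddCommGroup M] [Module S M] [Module Rᵐᵒᵖ M]

namespace TriangularRing

variable {R S M}

instance : Zero (TriangularRing R S M) := ⟨⟨0, 0, 0⟩⟩
instance : One (TriangularRing R S M) := ⟨⟨1, 0, 1⟩⟩
instance : Add (TriangularRing R S M) := ⟨fun x y => ⟨x.r + y.r, x.m + y.m, x.s + y.s⟩⟩
instance : Neg (TriangularRing R S M) := ⟨fun x => ⟨-x.r, -x.m, -x.s⟩⟩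
/-- Matrix multiplication: the lower left entry of a product is `m r' + s m'`. -/
instance : Mul (TriangularRing R S M) :=
  ⟨fun x y => ⟨x.r * y.r, MulOpposite.op y.r • x.m + x.s • y.m, x.s * y.s⟩⟩

@[simp] lemma zero_r : (0 : TriangularRing R S M).r = 0 := rfl
@[simp] lemma zero_m : (0 : TriangularRing R S M).m = 0 := rfl
@[simp] lemma zero_s : (0 : TriangularRing R S M).s = 0 := rfl
@[simp] lemma one_r : (1 : TriangularRing R S M).r = 1 := rfl
@[simp] lemma one_m : (1 : TriangularRing R S M).m = 0 := rfl
@[simp] lemma one_s : (1 : TriangularRing R S M).s = 1 := rfl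
@[simp] lemma add_r (x y : TriangularRing R S M) : (x + y).r = x.r + y.r := rfl
@[simp] lemma add_m (x y : TriangularRing R S M) : (x + y).m = x.m + y.m := rfl
@[simp] lemma add_s (x y : TriangularRing R S M) : (x + y).s = x.s + y.s := rfl
@[simp] lemma neg_r (x : TriangularRing R S M) : (-x).r = -x.r := rfl
@[simp] lemma neg_m (x : TriangularRing R S M) : (-x).m = -x.m := rfl
@[simp] lemma neg_s (x : TriangularRing R S M) : (-x).s = -x.s := rfl
@[simp] lemma mul_r (x y : TriangularRing R S M) : (x * y).r = x.r * y.r := rfl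
@[simp] lemma mul_m (x y : TriangularRing R S M) :
    (x * y).m = MulOpposite.op y.r • x.m + x.s • y.m := rfl
@[simp] lemma mul_s (x y : TriangularRing R S M) : (x * y).s = x.s * y.s := rfl

instance [SMulCommClass S Rᵐᵒᵖ M] : Ring (TriangularRing R S M) where
  add_assoc x y z := by ext <;> simp [add_assoc]
  zero_add x := by ext <;> simp
  add_zero x := by ext <;> simp
  add_comm x y := by ext <;> simp [add_comm]
  neg_add_cancel x := by ext <;> simp
  nsmul := nsmulRec
  zsmul := zsmulRec
  mul_assoc x y z := by
    ext
    · simp [mul_assoc]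
    · simp [mul_smul, smul_add, add_assoc, smul_comm x.s (MulOpposite.op z.r) y.m]
    · simp [mul_assoc]
  one_mul x := by ext <;> simp
  mul_one x := by ext <;> simp
  zero_mul x := by ext <;> simp
  mul_zero x := by ext <;> simp
  left_distrib x y z := by
    ext
    · simp [mul_add]
    · simp [add_smul, smul_add]; abel
    · simp [mul_add]
  right_distrib x y z := by
    ext
    · simp [add_mul]
    · simp [add_smul, smul_add]; abel
    · simp [add_mul]

end TriangularRing

/-- The tensor product `M ⊗_R W` of an `S`-`R`-bimodule and a left `R`-module, as a left
`S`-module: the quotient of `M ⊗_ℤ W` by the relations `mr ⊗ w = m ⊗ rw`. -/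
abbrev BimoduleTensor (W : Type u) [AddCommGroup W] [Module R W] : Type u :=
  (M ⊗[ℤ] W) ⧸ (Submodule.span S
    {x : M ⊗[ℤ] W | ∃ (m : M) (r : R) (w : W),
      x = (MulOpposite.op r • m) ⊗ₜ[ℤ] w - m ⊗ₜ[ℤ] (r • w)})

/-- The class of `m ⊗ w` in `M ⊗_R W`. -/
def BimoduleTensor.tmul {W : Type u} [AddCommGroup W] [Module R W] (m : M) (w : W) :
    BimoduleTensor R S M W :=
  Submodule.Quotient.mk (m ⊗ₜ[ℤ] w)

lemma BimoduleTensor.tmul_smul {W : Type u} [AddCommGroup W] [Module R W] (m : M) (r : R) (w : W) :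
    BimoduleTensor.tmul R S M (MulOpposite.op r • m) w = BimoduleTensor.tmul R S M m (r • w) :=
  (Submodule.Quotient.eq _).2 (Submodule.subset_span ⟨m, r, w, rfl⟩)

lemma BimoduleTensor.add_tmul {W : Type u} [AddCommGroup W] [Module R W] (m m' : M) (w : W) :
    BimoduleTensor.tmul R S M (m + m') w =
      BimoduleTensor.tmul R S M m w + BimoduleTensor.tmul R S M m' w := by
  simp only [BimoduleTensor.tmul, TensorProduct.add_tmul, Submodule.Quotient.mk_add]

lemma BimoduleTensor.tmul_add {W : Type u} [AddCommGroup W] [Module R W] (m : M) (w w' : W) :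
    BimoduleTensor.tmul R S M m (w + w') =
      BimoduleTensor.tmul R S M m w + BimoduleTensor.tmul R S M m w' := by
  simp only [BimoduleTensor.tmul, TensorProduct.tmul_add, Submodule.Quotient.mk_add]

lemma BimoduleTensor.smul_tmul {W : Type u} [AddCommGroup W] [Module R W] (s : S) (m : M) (w : W) :
    BimoduleTensor.tmul R S M (s • m) w = s • BimoduleTensor.tmul R S M m w := by
  simp only [BimoduleTensor.tmul, ← Submodule.Quotient.mk_smul, TensorProduct.smul_tmul']

lemma BimoduleTensor.zero_tmul {W : Type u} [AddCommGroup W] [Module R W] (w : W) :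
    BimoduleTensor.tmul R S M 0 w = 0 := by
  simp only [BimoduleTensor.tmul, TensorProduct.zero_tmul, Submodule.Quotient.mk_zero]

lemma BimoduleTensor.tmul_zero {W : Type u} [AddCommGroup W] [Module R W] (m : M) :
    BimoduleTensor.tmul R S M m (0 : W) = 0 := by
  simp only [BimoduleTensor.tmul, TensorProduct.tmul_zero, Submodule.Quotient.mk_zero]

/-- Triples `(W, V, f : M ⊗_R W → V)`. -/
structure ModuleTriple where
  W : ModuleCat.{u} R
  V : ModuleCat.{u} S
  f : BimoduleTensor R S M W →ₗ[S] V

namespace ModuleTriple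

variable {R S M}

/-- The abelian group `W ⊕ V` underlying the module given by a triple. -/
def Carrier (X : ModuleTriple R S M) : Type u := X.W × X.V

instance (X : ModuleTriple R S M) : AddCommGroup X.Carrier :=
  inferInstanceAs (AddCommGroup (X.W × X.V))

/-- The action `[[r, 0], [m, s]] (w, v) = (r w, f (m ⊗ w) + s v)`. -/
instance [SMulCommClass S Rᵐᵒᵖ M] (X : ModuleTriple R S M) :
    Module (TriangularRing R S M) X.Carrier where
  smul t x := (t.r • x.1, X.f (BimoduleTensor.tmul R S M t.m x.1) + t.s • x.2)
  one_smul x := by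
    refine Prod.ext (one_smul R x.1) ?_
    change X.f (BimoduleTensor.tmul R S M 0 x.1) + (1 : S) • x.2 = x.2
    rw [BimoduleTensor.zero_tmul, map_zero, zero_add, one_smul]
  mul_smul t t' x := by
    refine Prod.ext (mul_smul t.r t'.r x.1) ?_
    change X.f (BimoduleTensor.tmul R S M (MulOpposite.op t'.r • t.m + t.s • t'.m) x.1)
        + (t.s * t'.s) • x.2
      = X.f (BimoduleTensor.tmul R S M t.m (t'.r • x.1))
        + t.s • (X.f (BimoduleTensor.tmul R S M t'.m x.1) + t'.s • x.2)
    rw [BimoduleTensor.add_tmul, BimoduleTensor.tmul_smul, BimoduleTensor.smul_tmul, map_add,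
      map_smul, smul_add, mul_smul, add_assoc]
  smul_zero t := by
    refine Prod.ext (smul_zero t.r) ?_
    change X.f (BimoduleTensor.tmul R S M t.m (0 : X.W)) + t.s • (0 : X.V) = 0
    rw [BimoduleTensor.tmul_zero, map_zero, smul_zero, zero_add]
  smul_add t x y := by
    refine Prod.ext (smul_add t.r x.1 y.1) ?_
    change X.f (BimoduleTensor.tmul R S M t.m (x.1 + y.1)) + t.s • (x.2 + y.2)
      = (X.f (BimoduleTensor.tmul R S M t.m x.1) + t.s • x.2)
        + (X.f (BimoduleTensor.tmul R S M t.m y.1) + t.s • y.2)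
    rw [BimoduleTensor.tmul_add, map_add, smul_add]
    abel
  add_smul t t' x := by
    refine Prod.ext (add_smul t.r t'.r x.1) ?_
    change X.f (BimoduleTensor.tmul R S M (t.m + t'.m) x.1) + (t.s + t'.s) • x.2
      = (X.f (BimoduleTensor.tmul R S M t.m x.1) + t.s • x.2)
        + (X.f (BimoduleTensor.tmul R S M t'.m x.1) + t'.s • x.2)
    rw [BimoduleTensor.add_tmul, map_add, add_smul]
    abel
  zero_smul x := by
    refine Prod.ext (zero_smul R x.1) ?_
    change X.f (BimoduleTensor.tmul R S M 0 x.1) + (0 : S) • x.2 = 0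
    rw [BimoduleTensor.zero_tmul, map_zero, zero_smul, zero_add]

variable (R M) in
/-- The triple `(0, V, 0)`. -/
def ofRight (V : ModuleCat.{u} S) : ModuleTriple R S M where
  W := ModuleCat.of R PUnit
  V := V
  f := 0

end ModuleTriple

end Triangular

section EndExtension

variable (A E : Type u) [Ring A] [AddCommGroup E] [Module A E]

/-- The right action of `R = End_A(E)ᵒᵖ` on `E`, by `e · r = r(e)`. -/
instance endOpRightModule : Module (Module.End A E)ᵐᵒᵖᵐᵒᵖ E :=
  Module.compHom E (RingEquiv.opOp (Module.End A E)).symm.toRingHom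

lemma endOp_smul_def (r : (Module.End A E)ᵐᵒᵖ) (e : E) :
    MulOpposite.op r • e = (MulOpposite.unop r : Module.End A E) e := rfl

instance endOpRightModule_smulCommClass : SMulCommClass A (Module.End A E)ᵐᵒᵖᵐᵒᵖ E where
  smul_comm a r e := ((MulOpposite.unop (MulOpposite.unop r) : Module.End A E).map_smul a e).symm

/-- The algebra `A[E]`: the triangular matrix ring of `R = End_A(E)ᵒᵖ`, `A` and the bimodule `E`. -/
abbrev EndExtension : Type u := TriangularRing (Module.End A E)ᵐᵒᵖ A E

variable {A}

/-- `Hom_A(E, I)` as a left module over `R = End_A(E)ᵒᵖ`, by `r · f = f ∘ r`. -/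
@[reducible]
def homEndOpModule (I : ModuleCat.{u} A) : Module (Module.End A E)ᵐᵒᵖ (E →ₗ[A] I) where
  smul r f := f ∘ₗ (MulOpposite.unop r : Module.End A E)
  one_smul _ := rfl
  mul_smul _ _ _ := rfl
  smul_zero _ := rfl
  smul_add _ _ _ := rfl
  add_smul r r' f := LinearMap.ext fun e => f.map_add (r.unop e) (r'.unop e)
  zero_smul f := LinearMap.ext fun _ => f.map_zero

/-- `Hom_A(E, I)` as an object of the category of left `R`-modules. -/
def homEndOp (I : ModuleCat.{u} A) : ModuleCat.{u} (Module.End A E)ᵐᵒᵖ :=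
  letI := homEndOpModule E I
  ModuleCat.of (Module.End A E)ᵐᵒᵖ (E →ₗ[A] I)

/-- The evaluation map `η : E ⊗_R Hom_A(E, I) → I`, `η (e ⊗ f) = f e`. -/
def evalEta (I : ModuleCat.{u} A) :
    BimoduleTensor (Module.End A E)ᵐᵒᵖ A E (homEndOp E I) →ₗ[A] I :=
  Submodule.liftQ _
    (TensorProduct.AlgebraTensorModule.lift
      { toFun := fun e =>
          { toFun := fun f : E →ₗ[A] I => f e
            map_add' := fun _ _ => rfl
            map_smul' := fun n f => LinearMap.smul_apply n f e }
        map_add' := fun e e' => LinearMap.ext fun f : E →ₗ[A] I => f.map_add e e'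
        map_smul' := fun a e => LinearMap.ext fun f : E →ₗ[A] I => f.map_smul a e } :
      E ⊗[ℤ] (homEndOp E I) →ₗ[A] I)
    (by
      rw [Submodule.span_le]
      rintro _ ⟨e, r, f, rfl⟩
      rw [SetLike.mem_coe, LinearMap.mem_ker, map_sub, sub_eq_zero]
      rfl)

lemma evalEta_tmul (I : ModuleCat.{u} A) (e : E) (f : E →ₗ[A] I) :
    evalEta E I (BimoduleTensor.tmul (Module.End A E)ᵐᵒᵖ A E (W := homEndOp E I) e f) = f e :=
  rfl

/-- The triple `(Hom_A(E, I), I, η)`. -/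
def evalTriple (I : ModuleCat.{u} A) : ModuleTriple (Module.End A E)ᵐᵒᵖ A E where
  W := homEndOp E I
  V := I
  f := evalEta E I

/-- The `A[E]`-module `(0, T, 0) ⊕ ⨁ᵢ (Hom_A(E, Iᵢ), Iᵢ, ηᵢ)` for `E = ⨁ᵢ Iᵢ`. -/
def extendedTilting {r : ℕ} (I : Fin r → ModuleCat.{u} A) (T : ModuleCat.{u} A) :
    ModuleCat.{u} (EndExtension A (∀ i, I i)) :=
  ModuleCat.of (EndExtension A (∀ i, I i))
    ((ModuleTriple.ofRight (Module.End A (∀ i, I i))ᵐᵒᵖ (∀ i, I i) T).Carrier ×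
      (∀ i, (evalTriple (∀ j, I j) (I i)).Carrier))

end EndExtension

end

noncomputable section

/-! ### Krull–Schmidt theory for modules of finite length. -/

section Indecomposables

variable {Λ : Type u} [Ring Λ]

/-! Two observations make tilting modules in `C_Λ` easy to recognise. By
`isInC_of_surjective_of_injective`, membership in `C_Λ` only needs one finitely generated
projective-injective module above and one below. Rigidity then costs nothing beyond `pd ≤ 1`: in
that case `Ext¹(X, -)` is right exact, so it vanishes on quotients of injectives
(`subsingleton_ext_one_of_injective_surjective`).

Over the Auslander algebra `A`, dominant dimension at least 2 gives `0 → A → I⁰ → I¹` with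
projective-injective terms, and minimality makes them finitely generated. Let `C` be the image of
`I⁰ → I¹`. Since `I¹/C` has projective dimension at most 2 and `I¹` is projective, `pd C ≤ 1`. Hence
`I⁰ ⊕ C` is a tilting module up to multiplicities, with coresolution `0 → A → I⁰ → C → 0`, and lies
in `C_A`.

To pass to `A[E]`, two full functors are compared. The functor `V ↦ (0, V, 0)` is left adjoint to
the exact restriction `X ↦ V`, so it preserves projectives and the bound `pd ≤ 1`. The functor `V ↦
(Hom(E, V), V, η)` is right adjoint to the same restriction, so it preserves injectives. They agree
where `Hom(E, V) = 0`; therefore `(0, Q, 0)` is projective-injective for every finitely generated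
projective-injective `Q`. The modules `(Hom(E, Iᵢ), Iᵢ, ηᵢ)` are injective because `Iᵢ` is, and
projective because `Iᵢ` is a summand of `E`: their sum is the first column of `A[E]`. The second
column is `(0, A, 0)`. So a coresolution of `A` by `T` becomes one of `A[E]` after adding the first
column to its first two terms.

In part 3, orthogonality kills all components of a map `E → Iᵢ` except the one on `Iᵢ`, and `ηᵢ` is
bijective for any summand of `E`, since every tensor can be rewritten with the projection `E → Iᵢ`
as right factor. -/

lemma CategoryTheory.Indecomposable.nontrivial_module {X : ModuleCat.{u} Λ}
    (hX : Indecomposable X) : Nontrivial X := by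
  rw [← not_subsingleton_iff_nontrivial]
  exact fun h => hX.1 (ModuleCat.isZero_iff_subsingleton.2 h)

lemma CategoryTheory.Indecomposable.eq_bot_or_eq_bot_of_isCompl {X : ModuleCat.{u} Λ}
    (hX : Indecomposable X)
    {p q : Submodule Λ X} (h : IsCompl p q) : p = ⊥ ∨ q = ⊥ := by
  have e : X ≅ ModuleCat.of Λ p ⊞ ModuleCat.of Λ q :=
    (LinearEquiv.toModuleIso (Submodule.prodEquivOfIsCompl p q h).symm : X ≅ ModuleCat.of Λ (p × q))
      ≪≫ (ModuleCat.biprodIsoProd (ModuleCat.of Λ p) (ModuleCat.of Λ q)).symm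
  simpa only [ModuleCat.isZero_iff_subsingleton, ← Submodule.subsingleton_iff_eq_bot]
    using hX.2 _ _ e

/-- An idempotent splits `X` into range and kernel, and a biproduct decomposition yields an
idempotent. The criterion sees only endomorphisms, so it can be carried along the fully faithful
functors to `A[E]`-modules. -/
lemma indecomposable_iff {X : ModuleCat.{u} Λ} :
    Indecomposable X ↔
      Nontrivial X ∧ ∀ e : X →ₗ[Λ] X, e ∘ₗ e = e → e = 0 ∨ e = LinearMap.id := by
  refine ⟨fun hX => ⟨hX.nontrivial_module, fun e he => ?_⟩, fun ⟨hX, h⟩ => ⟨?_, fun Y Z i => ?_⟩⟩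
  · refine (hX.eq_bot_or_eq_bot_of_isCompl (LinearMap.IsIdempotentElem.isCompl he)).imp
      LinearMap.range_eq_bot.1 fun hk => ?_
    ext x
    exact LinearMap.ker_eq_bot.1 hk (LinearMap.congr_fun he x)
  · rw [ModuleCat.isZero_iff_subsingleton, not_subsingleton_iff_nontrivial]
    exact hX
  · have key := h (i.hom ≫ Limits.biprod.fst ≫ Limits.biprod.inl ≫ i.inv).hom (by
      rw [← ModuleCat.hom_comp]
      simp)
    rcases key with h0 | h1
    · left
      have h0' : i.hom ≫ Limits.biprod.fst ≫ Limits.biprod.inl ≫ i.inv = 0 :=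
        ModuleCat.hom_ext h0
      rw [Limits.IsZero.iff_id_eq_zero]
      have : Limits.biprod.inl ≫ i.inv ≫ (i.hom ≫ Limits.biprod.fst ≫ Limits.biprod.inl ≫ i.inv)
        ≫ i.hom ≫ Limits.biprod.fst = 𝟙 Y := by simp
      rw [← this, h0']
      simp
    · right
      have h1' : i.hom ≫ Limits.biprod.fst ≫ Limits.biprod.inl ≫ i.inv = 𝟙 X :=
        ModuleCat.hom_ext h1
      rw [Limits.IsZero.iff_id_eq_zero]
      have : Limits.biprod.inr ≫ i.inv ≫ 𝟙 X ≫ i.hom ≫ Limits.biprod.snd = 𝟙 Z := by simp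
      rw [← this, ← h1']
      simp

/-- Fitting's lemma. -/
lemma CategoryTheory.Indecomposable.isUnit_or_isNilpotent {X : ModuleCat.{u} Λ}
    (hX : Indecomposable X)
    [IsArtinian Λ X] [IsNoetherian Λ X] (f : Module.End Λ X) : IsUnit f ∨ IsNilpotent f := by
  obtain ⟨n, hn⟩ := Filter.eventually_atTop.1 f.eventually_isCompl_ker_pow_range_pow
  -- The exponent is `n + 1` because a unit power forces a unit base only for a nonzero exponent.
  have h := hn (n + 1) (Nat.le_succ n)
  rcases hX.eq_bot_or_eq_bot_of_isCompl h with h0 | h0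
  · left
    have htop : LinearMap.range (f ^ (n + 1)) = ⊤ := by
      simpa [h0] using h.sup_eq_top
    refine (isUnit_pow_iff (Nat.succ_ne_zero n)).1 ((Module.End.isUnit_iff _).2 ?_)
    exact ⟨LinearMap.ker_eq_bot.1 h0, LinearMap.range_eq_top.1 htop⟩
  · exact Or.inr ⟨n + 1, LinearMap.range_eq_bot.1 h0⟩

/-- The endomorphism ring is local: after dividing by the unit `f + g` the sum is `1`, and if the
first term is nilpotent then the second, being `1` minus it, is a unit. -/
lemma CategoryTheory.Indecomposable.isUnit_or_isUnit_of_isUnit_add {X : ModuleCat.{u} Λ}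
    (hX : Indecomposable X)
    [IsArtinian Λ X] [IsNoetherian Λ X] {f g : Module.End Λ X} (h : IsUnit (f + g)) :
    IsUnit f ∨ IsUnit g := by
  obtain ⟨v, hv⟩ := h
  have hs : ↑v⁻¹ * f + ↑v⁻¹ * g = 1 := by rw [← mul_add, ← hv, Units.inv_mul]
  rcases hX.isUnit_or_isNilpotent (↑v⁻¹ * f) with h1 | h1
  · exact Or.inl ((Units.isUnit_units_mul v⁻¹ f).1 h1)
  · right
    have := h1.isUnit_one_sub
    rw [← hs, add_sub_cancel_left] at this
    exact (Units.isUnit_units_mul v⁻¹ g).1 this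

lemma CategoryTheory.Indecomposable.exists_isUnit_of_isUnit_sum {X : ModuleCat.{u} Λ}
    (hX : Indecomposable X)
    [IsArtinian Λ X] [IsNoetherian Λ X] {ι : Type*} (s : Finset ι) (f : ι → Module.End Λ X)
    (h : IsUnit (∑ i ∈ s, f i)) : ∃ i ∈ s, IsUnit (f i) := by
  classical
  have := hX.nontrivial_module
  induction s using Finset.induction_on with
  | empty => simp at h
  | insert a s ha ih =>
    rw [Finset.sum_insert ha] at h
    rcases hX.isUnit_or_isUnit_of_isUnit_add h with h1 | h1
    · exact ⟨a, Finset.mem_insert_self a s, h1⟩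
    · obtain ⟨i, hi, hu⟩ := ih h1
      exact ⟨i, Finset.mem_insert_of_mem hi, hu⟩

/-- An indecomposable retract of a finite direct sum of indecomposables is isomorphic to one of
the summands. -/
lemma CategoryTheory.Indecomposable.exists_linearEquiv_of_retract_pi {Y : ModuleCat.{u} Λ}
    (hY : Indecomposable Y)
    [IsArtinian Λ Y] [IsNoetherian Λ Y] {ι : Type*} [Finite ι] {X : ι → ModuleCat.{u} Λ}
    (hX : ∀ i, Indecomposable (X i)) (s : Y →ₗ[Λ] ∀ i, X i) (p : (∀ i, X i) →ₗ[Λ] Y)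
    (hps : p ∘ₗ s = LinearMap.id) : ∃ i, Nonempty (Y ≃ₗ[Λ] X i) := by
  classical
  have := Fintype.ofFinite ι
  have hsum : ∑ i, (p ∘ₗ LinearMap.single Λ (fun i => X i) i ∘ₗ LinearMap.proj i ∘ₗ s :
      Module.End Λ Y) = 1 := by
    ext y
    simp only [LinearMap.sum_apply, LinearMap.comp_apply]
    rw [← map_sum]
    simp only [LinearMap.proj_apply, LinearMap.coe_single]
    rw [Finset.univ_sum_single]
    exact LinearMap.congr_fun hps y
  obtain ⟨i, -, v, hv⟩ := hY.exists_isUnit_of_isUnit_sum Finset.univ _ (hsum ▸ isUnit_one)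
  set a : Y →ₗ[Λ] X i := LinearMap.proj i ∘ₗ s
  set b : X i →ₗ[Λ] Y := (↑v⁻¹ : Module.End Λ Y) ∘ₗ p ∘ₗ LinearMap.single Λ (fun i => X i) i
  have hba : b ∘ₗ a = LinearMap.id := by
    have : (↑v⁻¹ : Module.End Λ Y) * ↑v = 1 := Units.inv_mul v
    rw [hv] at this
    exact this
  have hba' : ∀ y, b (a y) = y := LinearMap.congr_fun hba
  have := hY.nontrivial_module
  obtain ⟨y, hy⟩ := exists_ne (0 : Y)
  refine ⟨i, ⟨LinearEquiv.ofLinearMap a b ?_ hba⟩⟩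
  -- From `b ∘ a = id`, the map `a ∘ b` is idempotent; it is nonzero because `Y` is, hence it is the
  -- identity of the indecomposable `X i`.
  refine ((indecomposable_iff.1 (hX i)).2 (a ∘ₗ b) ?_).resolve_left fun h0 => hy ?_
  · ext x
    simp [hba']
  · have := LinearMap.congr_fun h0 (a y)
    simp only [LinearMap.comp_apply, hba', LinearMap.zero_apply] at this
    rw [← hba' y, this, map_zero]

/-- Induction on length: a nontrivial idempotent splits `M` into two submodules of smaller length.
-/
lemma exists_linearEquiv_pi_indecomposable (M : ModuleCat.{u} Λ) [IsArtinian Λ M]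
    [IsNoetherian Λ M] :
    ∃ (ι : Type) (_ : Finite ι) (X : ι → ModuleCat.{u} Λ),
      (∀ i, Indecomposable (X i)) ∧ Nonempty (M ≃ₗ[Λ] ∀ i, X i) := by
  induction h : Module.length Λ M using WellFoundedLT.induction generalizing M with
  | ind n ih =>
    subst h
    by_cases h0 : Subsingleton M
    · exact ⟨Empty, inferInstance, fun i => i.elim, fun i => i.elim,
        ⟨LinearEquiv.ofSubsingleton _ _⟩⟩
    rw [not_subsingleton_iff_nontrivial] at h0
    by_cases hM : ∀ e : M →ₗ[Λ] M, e ∘ₗ e = e → e = 0 ∨ e = LinearMap.id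
    · exact ⟨Unit, inferInstance, fun _ => M, fun _ => indecomposable_iff.2 ⟨h0, hM⟩,
        ⟨(LinearEquiv.funUnique Unit Λ M).symm⟩⟩
    push Not at hM
    obtain ⟨e, he, he0, he1⟩ := hM
    have hc := LinearMap.IsIdempotentElem.isCompl (f := e) he
    have hr : LinearMap.range e ≠ ⊤ := fun hr => he1 <| by
      ext x
      obtain ⟨y, rfl⟩ := LinearMap.range_eq_top.1 hr x
      exact LinearMap.congr_fun he y
    have hk : LinearMap.ker e ≠ ⊤ := fun hk => he0 (LinearMap.ker_eq_top.1 hk)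
    obtain ⟨ι, _, X, hX, ⟨f⟩⟩ := ih _ (Submodule.length_lt hr)
      (ModuleCat.of Λ (LinearMap.range e)) rfl
    obtain ⟨κ, _, Y, hY, ⟨g⟩⟩ := ih _ (Submodule.length_lt hk)
      (ModuleCat.of Λ (LinearMap.ker e)) rfl
    refine ⟨ι ⊕ κ, inferInstance, Sum.elim X Y, by rintro (i | i); exacts [hX i, hY i], ⟨?_⟩⟩
    exact (Submodule.prodEquivOfIsCompl _ _ hc).symm ≪≫ₗ (LinearEquiv.prodCongr f g) ≪≫ₗ
      (LinearEquiv.sumPiEquivProdPi Λ ι κ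
        (fun i => ((Sum.elim X Y i : ModuleCat.{u} Λ) : Type u))).symm

/-- Irredundant representatives of the isomorphism classes in a finite family of modules. -/
lemma exists_irredundant_representatives {ι : Type*} [Finite ι] (X : ι → ModuleCat.{u} Λ) :
    ∃ (n : ℕ) (σ : Fin n → ι), (∀ i j, Nonempty (X (σ i) ≃ₗ[Λ] X (σ j)) → i = j) ∧
      ∀ i, ∃ j, Nonempty (X i ≃ₗ[Λ] X (σ j)) := by
  let S : Setoid ι :=
    { r := fun i j => Nonempty (X i ≃ₗ[Λ] X j)
      iseqv := ⟨fun i => ⟨LinearEquiv.refl Λ _⟩, fun ⟨e⟩ => ⟨e.symm⟩,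
        fun ⟨e⟩ ⟨f⟩ => ⟨e.trans f⟩⟩ }
  obtain ⟨n, ⟨e⟩⟩ := Finite.exists_equiv_fin (Quotient S)
  refine ⟨n, fun i => (e.symm i).out, fun i j h => ?_, fun i => ⟨e ⟦i⟧, ?_⟩⟩
  · apply e.symm.injective
    rw [← Quotient.out_eq (e.symm i), ← Quotient.out_eq (e.symm j)]
    exact Quotient.sound h
  · beta_reduce
    rw [Equiv.symm_apply_apply]
    exact Setoid.symm (Quotient.mk_out (s := S) i)

lemma isBasicModule_of_linearEquiv_pi {T : ModuleCat.{u} Λ} {ι : Type*} [Finite ι]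
    (X : ι → ModuleCat.{u} Λ) (hX : ∀ i, Indecomposable (X i))
    (hne : ∀ i j, Nonempty (X i ≃ₗ[Λ] X j) → i = j) (e : T ≃ₗ[Λ] ∀ i, X i) :
    IsBasicModule T := by
  obtain ⟨n, ⟨f⟩⟩ := Finite.exists_equiv_fin ι
  refine ⟨n, fun i => X (f.symm i), fun i => hX _, fun i j h => f.symm.injective (hne _ _ h), ⟨?_⟩⟩
  exact e ≪≫ₗ (LinearEquiv.piCongrLeft Λ (fun i => X i) f.symm).symm

end Indecomposables

/-! ### Closure properties of `add T`. -/

section AddClosure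

variable {Λ : Type u} [Ring Λ]

lemma IsInAdd.of_linearEquiv {T X Y : ModuleCat.{u} Λ} (e : Y ≃ₗ[Λ] X) (h : IsInAdd T X) :
    IsInAdd T Y := by
  obtain ⟨m, i, p, hpi⟩ := h
  refine ⟨m, i ∘ₗ e.toLinearMap, e.symm.toLinearMap ∘ₗ p, ?_⟩
  ext x
  simpa using congrArg e.symm (LinearMap.congr_fun hpi (e x))

lemma isInAdd_of_retract {T X : ModuleCat.{u} Λ} (i : X →ₗ[Λ] T) (p : T →ₗ[Λ] X)
    (h : p ∘ₗ i = LinearMap.id) : IsInAdd T X :=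
  ⟨1, LinearMap.pi fun _ => i, p ∘ₗ LinearMap.proj 0, by ext x; exact LinearMap.congr_fun h x⟩

lemma IsInAdd.of_retract {T X Y : ModuleCat.{u} Λ} (h : IsInAdd T X) (i : Y →ₗ[Λ] X)
    (p : X →ₗ[Λ] Y) (hpi : p ∘ₗ i = LinearMap.id) : IsInAdd T Y := by
  obtain ⟨m, j, q, hqj⟩ := h
  refine ⟨m, j ∘ₗ i, p ∘ₗ q, ?_⟩
  ext x
  have := LinearMap.congr_fun hqj (i x)
  simp only [LinearMap.comp_apply, LinearMap.id_apply] at this ⊢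
  rw [this]
  exact LinearMap.congr_fun hpi x

lemma isInAdd_pi {T : ModuleCat.{u} Λ} {ι : Type} [Finite ι] {X : ι → ModuleCat.{u} Λ}
    (h : ∀ i, IsInAdd T (X i)) : IsInAdd T (ModuleCat.of Λ (∀ i, X i)) := by
  choose m j q hqj using h
  have hqj' : ∀ i x, q i (j i x) = x := fun i => LinearMap.congr_fun (hqj i)
  obtain ⟨n, ⟨e⟩⟩ := Finite.exists_equiv_fin (Σ i, Fin (m i))
  refine ⟨n, LinearMap.pi fun k => LinearMap.proj (e.symm k).2 ∘ₗ j (e.symm k).1 ∘ₗ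
      LinearMap.proj (e.symm k).1,
    LinearMap.pi fun i => q i ∘ₗ LinearMap.pi fun k => LinearMap.proj (e ⟨i, k⟩), ?_⟩
  ext x i
  simp only [LinearMap.comp_apply, LinearMap.pi_apply, LinearMap.id_apply]
  refine Eq.trans (congrArg (q i) ?_) (hqj' i (x i))
  ext k
  simp only [LinearMap.pi_apply, LinearMap.proj_apply, LinearMap.comp_apply]
  rw [Equiv.symm_apply_apply]

lemma isInAdd_prod {T X Y : ModuleCat.{u} Λ} (hX : IsInAdd T X) (hY : IsInAdd T Y) :
    IsInAdd T (ModuleCat.of Λ (X × Y)) := by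
  obtain ⟨m, i, p, hpi⟩ := hX
  obtain ⟨n, j, q, hqj⟩ := hY
  have h := isInAdd_pi (X := fun _ : Fin m ⊕ Fin n => T)
    fun _ => isInAdd_of_retract LinearMap.id LinearMap.id rfl
  let e := LinearEquiv.sumArrowLequivProdArrow (Fin m) (Fin n) Λ T
  refine h.of_retract (e.symm.toLinearMap ∘ₗ i.prodMap j) (p.prodMap q ∘ₗ e.toLinearMap) ?_
  refine LinearMap.ext fun x => ?_
  simp only [LinearMap.comp_apply, LinearEquiv.coe_coe, LinearEquiv.apply_symm_apply]
  exact Prod.ext (LinearMap.congr_fun hpi x.1) (LinearMap.congr_fun hqj x.2)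

lemma IsInAdd.isGeneratedBy {T X : ModuleCat.{u} Λ} (h : IsInAdd T X) : IsGeneratedBy T X := by
  obtain ⟨m, i, p, hpi⟩ := h
  exact ⟨m, p, fun x => ⟨i x, LinearMap.congr_fun hpi x⟩⟩

lemma IsInAdd.isCogeneratedBy {T X : ModuleCat.{u} Λ} (h : IsInAdd T X) :
    IsCogeneratedBy T X := by
  obtain ⟨m, i, p, hpi⟩ := h
  exact ⟨m, i, Function.LeftInverse.injective (g := p) (LinearMap.congr_fun hpi)⟩

end AddClosure

/-! ### Projective-injective modules, the subcategory `C_Λ`, and basic versions of modules. -/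

section ProjInj

variable {Λ : Type u} [Ring Λ]

lemma projective_pi {ι : Type} [Finite ι] (X : ι → Type u) [∀ i, AddCommGroup (X i)]
    [∀ i, Module Λ (X i)] [∀ i, Module.Projective Λ (X i)] : Module.Projective Λ (∀ i, X i) := by
  classical
  have := Fintype.ofFinite ι
  exact Module.Projective.of_equiv (DFinsupp.linearEquivFunOnFintype (R := Λ) (M := X))

lemma projective_object_iff (X : ModuleCat.{u} Λ) : Projective X ↔ Module.Projective Λ X :=
  (IsProjective.iff_projective (R := Λ) X).symm

lemma injective_object_iff (X : ModuleCat.{u} Λ) : Injective X ↔ Module.Injective Λ X :=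
  (Module.injective_iff_injective_object Λ X).symm

lemma injective_of_retract {M N : Type u} [AddCommGroup M] [Module Λ M] [AddCommGroup N]
    [Module Λ N] [Module.Injective Λ N] (i : M →ₗ[Λ] N) (p : N →ₗ[Λ] M)
    (h : p ∘ₗ i = LinearMap.id) : Module.Injective Λ M where
  out X Y _ _ _ _ f hf g := by
    obtain ⟨l, hl⟩ := Module.Injective.out f hf (i ∘ₗ g)
    refine ⟨p ∘ₗ l, fun x => ?_⟩
    rw [LinearMap.comp_apply, hl]
    exact LinearMap.congr_fun h (g x)

lemma IsSumOfProjInj.properties {Q : ModuleCat.{u} Λ} (hQ : IsSumOfProjInj Q) :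
    Module.Finite Λ Q ∧ Module.Projective Λ Q ∧ Module.Injective Λ Q := by
  obtain ⟨t, X, hX, -, -, ⟨e⟩⟩ := hQ
  have h1 := fun i => (hX i).finite
  have h2 := fun i => (projective_object_iff _).1 (hX i).projective
  have h3 := fun i => (injective_object_iff _).1 (hX i).injective
  have := projective_pi (Λ := Λ) (fun i => X i)
  exact ⟨Module.Finite.equiv e.symm, Module.Projective.of_equiv e.symm,
    injective_of_retract e.toLinearMap e.symm.toLinearMap (by ext; simp)⟩

lemma injective_prod (M N : Type u) [AddCommGroup M] [Module Λ M] [AddCommGroup N] [Module Λ N]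
    [Module.Injective Λ M] [Module.Injective Λ N] : Module.Injective Λ (M × N) where
  out X Y _ _ _ _ f hf g := by
    obtain ⟨a, ha⟩ := Module.Injective.out f hf (LinearMap.fst Λ _ _ ∘ₗ g)
    obtain ⟨b, hb⟩ := Module.Injective.out f hf (LinearMap.snd Λ _ _ ∘ₗ g)
    exact ⟨a.prod b, fun x => Prod.ext (ha x) (hb x)⟩

variable [IsArtinianRing Λ]

/-- An indecomposable finitely generated projective is a retract of some `Λᵐ`, so by Krull–Schmidt
it occurs among the finitely many indecomposable summands of `Λ`. It remains to keep the injective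
ones, one per isomorphism class. -/
lemma exists_isSumOfProjInj : ∃ Q : ModuleCat.{u} Λ, IsSumOfProjInj Q := by
  obtain ⟨ι, _, X, hX, ⟨e⟩⟩ := exists_linearEquiv_pi_indecomposable (ModuleCat.of Λ Λ)
  let κ := {i : ι // Injective (X i)}
  obtain ⟨n, σ, hσ, hrep⟩ := exists_irredundant_representatives (fun i : κ => X i)
  refine ⟨ModuleCat.of Λ (∀ i, X (σ i)), n, fun i => X (σ i), fun i => ?_, hσ, fun Y hY => ?_,
    ⟨LinearEquiv.refl Λ _⟩⟩
  · classical
    have hs : (LinearMap.proj (σ i).1 ∘ₗ e.toLinearMap) ∘ₗ (e.symm.toLinearMap ∘ₗ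
        LinearMap.single Λ (fun i => X i) (σ i).1) = LinearMap.id := by
      ext x
      simp
    refine ⟨?_, hX _, ?_, (σ i).2⟩
    · exact Module.Finite.of_surjective (M := Λ) (LinearMap.proj (σ i).1 ∘ₗ e.toLinearMap)
        fun x => ⟨_, LinearMap.congr_fun hs x⟩
    · rw [projective_object_iff]
      exact Module.Projective.of_split (M := Λ) _ _ hs
  · have := hY.finite
    have hYi := hY.injective
    have := (projective_object_iff Y).1 hY.projective
    obtain ⟨m, f, hf⟩ := Module.Finite.exists_fin' Λ Y
    obtain ⟨g, hg⟩ := Module.projective_lifting_property f LinearMap.id hf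
    let E : (Fin m → Λ) ≃ₗ[Λ] ∀ a : Fin m × ι, X a.2 :=
      (LinearEquiv.piCongrRight fun _ => e) ≪≫ₗ
        { toFun := fun x a => x a.1 a.2
          invFun := fun y k i => y (k, i)
          map_add' := fun _ _ => rfl
          map_smul' := fun _ _ => rfl
          left_inv := fun _ => rfl
          right_inv := fun _ => rfl }
    obtain ⟨⟨k, i⟩, ⟨d⟩⟩ := hY.indecomposable.exists_linearEquiv_of_retract_pi
      (X := fun a : Fin m × ι => X a.2) (fun a => hX a.2) (E.toLinearMap ∘ₗ g)
      (f ∘ₗ E.symm.toLinearMap) (by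
        ext y
        simpa using LinearMap.congr_fun hg y)
    have hi : Injective (X i) := Injective.of_iso d.toModuleIso hYi
    obtain ⟨j, ⟨c⟩⟩ := hrep ⟨i, hi⟩
    exact ⟨j, ⟨d.trans c⟩⟩

lemma IsSumOfProjInj.isInAdd {Q : ModuleCat.{u} Λ} (hQ : IsSumOfProjInj Q) (P : ModuleCat.{u} Λ)
    [Module.Finite Λ P] [Module.Projective Λ P] [Module.Injective Λ P] : IsInAdd Q P := by
  classical
  obtain ⟨t, X, hX, -, hrep, ⟨c⟩⟩ := hQ
  obtain ⟨ι, _, Y, hY, ⟨e⟩⟩ := exists_linearEquiv_pi_indecomposable P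
  refine IsInAdd.of_linearEquiv (X := ModuleCat.of Λ (∀ i, Y i)) e (isInAdd_pi fun i => ?_)
  have hs : (LinearMap.proj i ∘ₗ e.toLinearMap) ∘ₗ (e.symm.toLinearMap ∘ₗ
      LinearMap.single Λ (fun i => Y i) i) = LinearMap.id := by
    ext x
    simp
  have hYi : IsIndecProjInj (Y i) := by
    refine ⟨?_, hY i, ?_, ?_⟩
    · exact Module.Finite.of_surjective (M := P) (LinearMap.proj i ∘ₗ e.toLinearMap)
        fun x => ⟨_, LinearMap.congr_fun hs x⟩
    · rw [projective_object_iff]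
      exact Module.Projective.of_split (M := P) _ _ hs
    · rw [injective_object_iff]
      exact injective_of_retract (N := P) _ _ hs
  obtain ⟨j, ⟨d⟩⟩ := hrep _ hYi
  refine IsInAdd.of_linearEquiv d (isInAdd_of_retract
    (c.symm.toLinearMap ∘ₗ LinearMap.single Λ (fun i => X i) j)
    (LinearMap.proj j ∘ₗ c.toLinearMap) ?_)
  ext x
  simp

/-- A finitely generated module lies in `C_Λ` as soon as it is a quotient and a submodule of
finitely generated projective-injective modules. -/
lemma isInC_of_surjective_of_injective {M : ModuleCat.{u} Λ} (P P' : ModuleCat.{u} Λ)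
    [Module.Finite Λ P] [Module.Projective Λ P] [Module.Injective Λ P]
    [Module.Finite Λ P'] [Module.Projective Λ P'] [Module.Injective Λ P']
    (f : P →ₗ[Λ] M) (hf : Function.Surjective f) (g : M →ₗ[Λ] P') (hg : Function.Injective g) :
    IsInC M := by
  obtain ⟨Q, hQ⟩ := exists_isSumOfProjInj (Λ := Λ)
  refine ⟨Module.Finite.of_surjective f hf, Q, hQ, ?_, ?_⟩
  · obtain ⟨m, p, hp⟩ := (hQ.isInAdd P).isGeneratedBy
    exact ⟨m, f ∘ₗ p, hf.comp hp⟩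
  · obtain ⟨m, i, hi⟩ := (hQ.isInAdd P').isCogeneratedBy
    exact ⟨m, i ∘ₗ g, hi.comp hg⟩

/-- Dropping repeated indecomposable summands does not change `add M`; this turns the tilting
candidate into a basic one. -/
lemma exists_isBasicModule_retract (M : ModuleCat.{u} Λ) [Module.Finite Λ M] :
    ∃ T : ModuleCat.{u} Λ, IsBasicModule T ∧ IsInAdd T M ∧
      ∃ (i : T →ₗ[Λ] M) (p : M →ₗ[Λ] T), p ∘ₗ i = LinearMap.id := by
  classical
  obtain ⟨ι, _, X, hX, ⟨e⟩⟩ := exists_linearEquiv_pi_indecomposable M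
  obtain ⟨n, σ, hσ, hrep⟩ := exists_irredundant_representatives X
  refine ⟨ModuleCat.of Λ (∀ j, X (σ j)), ⟨n, fun j => X (σ j), fun j => hX _, hσ,
    ⟨LinearEquiv.refl Λ _⟩⟩, ?_, ?_⟩
  · refine IsInAdd.of_linearEquiv (X := ModuleCat.of Λ (∀ i, X i)) e (isInAdd_pi fun i => ?_)
    obtain ⟨j, ⟨d⟩⟩ := hrep i
    refine IsInAdd.of_linearEquiv d (isInAdd_of_retract
      (LinearMap.single Λ (fun j => X (σ j)) j) (LinearMap.proj j) ?_)
    ext x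
    simp
  -- Distinct representatives sit at distinct indices, so including and then projecting leaves no
  -- cross terms.
  · have hinj : Function.Injective σ := fun a b h => hσ a b (h ▸ ⟨LinearEquiv.refl Λ _⟩)
    refine ⟨e.symm.toLinearMap ∘ₗ ∑ j, LinearMap.single Λ (fun i => X i) (σ j) ∘ₗ
        LinearMap.proj j, LinearMap.pi (fun j => LinearMap.proj (σ j)) ∘ₗ e.toLinearMap, ?_⟩
    refine LinearMap.ext fun x => funext fun k => ?_
    simp only [LinearMap.comp_apply, LinearMap.pi_apply, LinearEquiv.coe_coe,
      LinearEquiv.apply_symm_apply, LinearMap.sum_apply, LinearMap.proj_apply,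
      LinearMap.coe_single, Finset.sum_apply, LinearMap.id_apply]
    rw [Finset.sum_eq_single k]
    · simp
    · intro j _ hj
      exact Pi.single_eq_of_ne (fun h => hj (hinj h.symm)) _
    · simp

end ProjInj

/-! ### Projective dimension at most one. -/

section ProjectiveDimensionOne

variable {Λ : Type u} [Ring Λ]

lemma hasProjectiveDimensionLE_one_iff {P X : Type u} [AddCommGroup P] [Module Λ P]
    [AddCommGroup X] [Module Λ X] [Module.Projective Λ P] (π : P →ₗ[Λ] X)
    (hπ : Function.Surjective π) :
    HasProjectiveDimensionLE (ModuleCat.of Λ X) 1 ↔ Module.Projective Λ (LinearMap.ker π) := by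
  let S := ModuleCat.shortComplexOfCompEqZero (LinearMap.ker π).subtype π (by ext x; exact x.2)
  have hS : S.ShortExact := ModuleCat.shortComplex_shortExact S
    (LinearMap.exact_subtype_ker_map π) (Submodule.subtype_injective _) hπ
  have hP : Projective S.X₂ := (projective_object_iff _).2 ‹_›
  have h := hS.hasProjectiveDimensionLT_X₃_iff 0 hP
  exact h.trans (projective_iff_hasProjectiveDimensionLT_one.symm.trans (projective_object_iff _))

lemma hasProjectiveDimensionLE_one_prod {X Y : ModuleCat.{u} Λ}
    (hX : HasProjectiveDimensionLE X 1) (hY : HasProjectiveDimensionLE Y 1) :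
    HasProjectiveDimensionLE (ModuleCat.of Λ (X × Y)) 1 := by
  have : HasProjectiveDimensionLT (X ⊞ Y) 2 := inferInstance
  exact hasProjectiveDimensionLT_of_iso (ModuleCat.biprodIsoProd X Y) 2

lemma hasProjectiveDimensionLE_one_of_retract {X Y : ModuleCat.{u} Λ}
    (hY : HasProjectiveDimensionLE Y 1) (i : X →ₗ[Λ] Y) (p : Y →ₗ[Λ] X)
    (h : p ∘ₗ i = LinearMap.id) : HasProjectiveDimensionLE X 1 :=
  Retract.hasProjectiveDimensionLT (Y := Y)
    ⟨ModuleCat.ofHom i, ModuleCat.ofHom p, ModuleCat.hom_ext h⟩ 2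

lemma hasProjectiveDimensionLE_one_of_projective {X : ModuleCat.{u} Λ} (hX : Projective X) :
    HasProjectiveDimensionLE X 1 :=
  hasProjectiveDimensionLT_of_ge X 1 2 (by norm_num)

/-- Modules of projective dimension at most one have no extensions by quotients of injectives. -/
lemma subsingleton_ext_one_of_injective_surjective {X Y : ModuleCat.{u} Λ}
    (hX : HasProjectiveDimensionLE X 1) {J : Type u} [AddCommGroup J] [Module Λ J]
    [Module.Injective Λ J] (f : J →ₗ[Λ] Y) (hf : Function.Surjective f) :
    Subsingleton (Abelian.Ext X Y 1) := by
  let S := ModuleCat.shortComplexOfCompEqZero (LinearMap.ker f).subtype f (by ext x; exact x.2)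
  have hS : S.ShortExact := ModuleCat.shortComplex_shortExact S
    (LinearMap.exact_subtype_ker_map f) (Submodule.subtype_injective _) hf
  have hJ : Injective S.X₂ := (injective_object_iff _).2 ‹_›
  refine subsingleton_of_forall_eq 0 fun x => ?_
  -- The obstruction to lifting the class along `J → Y` lies in `Ext²(X, ker f) = 0`, and the lift
  -- lies in `Ext¹(X, J) = 0`.
  obtain ⟨y, rfl⟩ := Abelian.Ext.covariant_sequence_exact₃ X hS x (n₁ := 2) rfl
    (Abelian.Ext.eq_zero_of_hasProjectiveDimensionLT _ 2 le_rfl)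
  rw [Abelian.Ext.eq_zero_of_injective y, Abelian.Ext.zero_comp]

end ProjectiveDimensionOne

/-! ### The tilting module of an Auslander algebra. -/

section DominantDimension

variable {Λ : Type u} [Ring Λ]

/-- Embed `P` in a free module. The generators of `N` involve finitely many coordinates, and
projection to these is injective on `N`, hence on `P` by essentiality. So `P` embeds in a finite
free module. This is what makes the terms of a minimal resolution finitely generated. -/
lemma finite_of_isEssentialSubmodule [IsNoetherianRing Λ] {P : Type u} [AddCommGroup P]
    [Module Λ P] [Module.Projective Λ P] {N : Submodule Λ P} (hN : N.FG)
    (hess : IsEssentialSubmodule N) : Module.Finite Λ P := by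
  classical
  obtain ⟨s, hs⟩ := Module.projective_def.1 ‹Module.Projective Λ P›
  obtain ⟨S, rfl⟩ := hN
  let F : Finset P := S.biUnion fun x => (s x).support
  have hF : Submodule.span Λ (S : Set P) ≤ (Finsupp.supported Λ Λ (F : Set P)).comap s := by
    rw [Submodule.span_le]
    intro x hx
    rw [SetLike.mem_coe, Submodule.mem_comap, Finsupp.mem_supported]
    exact_mod_cast Finset.subset_biUnion_of_mem (fun x => (s x).support) hx
  let q : P →ₗ[Λ] (F → Λ) := (LinearMap.pi fun a : F => Finsupp.lapply (a : P)) ∘ₗ s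
  refine Module.Finite.of_injective q (LinearMap.ker_eq_bot.1 (hess _ ?_))
  rw [eq_bot_iff]
  rintro x ⟨hx, hxq⟩
  have h0 : s x = 0 := by
    ext a
    by_cases ha : a ∈ F
    · exact congrFun (LinearMap.mem_ker.1 hxq) ⟨a, ha⟩
    · exact Finsupp.notMem_support_iff.1 fun h => ha (hF hx h)
  rw [Submodule.mem_bot, ← hs x, h0, map_zero]

lemma exists_projInj_copresentation [IsNoetherianRing Λ]
    (h : 2 ≤ dominantDimension (ModuleCat.of Λ Λ)) :
    ∃ (I₀ I₁ : ModuleCat.{u} Λ) (ι : Λ →ₗ[Λ] I₀) (d : I₀ →ₗ[Λ] I₁),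
      Module.Finite Λ I₀ ∧ Module.Projective Λ I₀ ∧ Module.Injective Λ I₀ ∧
      Module.Finite Λ I₁ ∧ Module.Projective Λ I₁ ∧ Module.Injective Λ I₁ ∧
      Function.Injective ι ∧ Function.Exact ι d := by
  have hk : ∃ I : InjectiveResolution (ModuleCat.of Λ Λ), IsMinimalInjectiveResolution I ∧
      Projective (I.cocomplex.X 0) ∧ Projective (I.cocomplex.X 1) := by
    -- If no minimal resolution has both first terms projective, every `k` in the defining supremum
    -- is at most `1`.
    by_contra hcon
    have : dominantDimension (ModuleCat.of Λ Λ) ≤ 1 := by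
      refine sSup_le fun k ⟨I, hI, hp⟩ => ?_
      by_contra hk
      rw [not_le] at hk
      exact hcon ⟨I, hI, hp 0 (lt_trans (by simp) hk), hp 1 (by simpa using hk)⟩
    exact absurd (h.trans this) (by norm_num)
  obtain ⟨I, hI, hp0, hp1⟩ := hk
  rw [projective_object_iff] at hp0 hp1
  let ι : Λ →ₗ[Λ] I.cocomplex.X 0 := (I.ι.f 0).hom
  let d : I.cocomplex.X 0 →ₗ[Λ] I.cocomplex.X 1 := (I.cocomplex.d 0 1).hom
  have hι : Function.Injective ι := (ModuleCat.mono_iff_injective (I.ι.f 0)).1 inferInstance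
  have hex : Function.Exact ι d := by
    have h1 : (ShortComplex.mk _ _ I.ι_f_zero_comp_complex_d).Exact :=
      ShortComplex.exact_of_f_is_kernel _ I.isLimitKernelFork
    exact (ShortComplex.ShortExact.moduleCat_exact_iff_function_exact _).1 h1
  have hex' : LinearMap.range d = LinearMap.ker (I.cocomplex.d 1 2).hom :=
    (I.exact_succ 0).moduleCat_range_eq_ker
  have hker : LinearMap.ker d = LinearMap.range ι := LinearMap.exact_iff.1 hex
  have hf0 : Module.Finite Λ (I.cocomplex.X 0) := by
    refine finite_of_isEssentialSubmodule (N := LinearMap.ker d) ?_ (hI 0)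
    rw [hker]
    exact Module.Finite.iff_fg.1 (Module.Finite.range ι)
  have hf1 : Module.Finite Λ (I.cocomplex.X 1) := by
    refine finite_of_isEssentialSubmodule (N := LinearMap.ker (I.cocomplex.d 1 2).hom) ?_ (hI 1)
    rw [← hex']
    exact Module.Finite.iff_fg.1 (Module.Finite.range d)
  exact ⟨_, _, ι, d, hf0, hp0, (injective_object_iff _).1 (I.injective 0), hf1, hp1,
    (injective_object_iff _).1 (I.injective 1), hι, hex⟩

/-- An Auslander algebra has a tilting module in `C_Λ`. -/
theorem IsAuslander.exists_isTilting_isInC [IsArtinianRing Λ] (h : IsAuslander Λ) :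
    ∃ T : ModuleCat.{u} Λ, IsTilting T ∧ IsInC T := by
  obtain ⟨hgl, hdom⟩ := h
  obtain ⟨I₀, I₁, ι, d, _, _, _, _, _, _, hι, hex⟩ := exists_projInj_copresentation hdom
  let C := LinearMap.range d
  -- `C` is a first syzygy of `I₁ ⧸ C`, whose projective dimension is at most 2.
  have hC : HasProjectiveDimensionLE (ModuleCat.of Λ C) 1 := by
    let S := ModuleCat.shortComplexOfCompEqZero C.subtype C.mkQ (by ext; simp)
    have hS : S.ShortExact := ModuleCat.shortComplex_shortExact S
      (LinearMap.exact_subtype_mkQ C) (Submodule.subtype_injective _) (Submodule.mkQ_surjective _)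
    have h2 : Projective S.X₂ := (projective_object_iff _).2 ‹_›
    have h3 : HasProjectiveDimensionLE S.X₃ 2 := by
      rw [← projectiveDimension_le_iff]
      have : Module.Finite Λ S.X₃ := inferInstanceAs (Module.Finite Λ (I₁ ⧸ C))
      exact (le_iSup₂ (f := fun (X : ModuleCat.{u} Λ) (_ : Module.Finite Λ X) =>
        projectiveDimension X) S.X₃ this).trans hgl
    exact hS.hasProjectiveDimensionLT_X₁ 2 (hasProjectiveDimensionLT_of_ge _ 1 2 (by norm_num)) h3
  let M := ModuleCat.of Λ (I₀ × C)
  have hM : HasProjectiveDimensionLE M 1 := hasProjectiveDimensionLE_one_prod (X := I₀)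
    (Y := ModuleCat.of Λ C)
    (hasProjectiveDimensionLE_one_of_projective ((projective_object_iff _).2 ‹_›)) hC
  have : Module.Finite Λ M := inferInstanceAs (Module.Finite Λ (I₀ × C))
  obtain ⟨T, hbasic, hadd, i, p, hpi⟩ := exists_isBasicModule_retract M
  have hp : Function.Surjective p := fun x => ⟨i x, LinearMap.congr_fun hpi x⟩
  have hi : Function.Injective i :=
    Function.LeftInverse.injective (g := p) (LinearMap.congr_fun hpi)
  have hT : HasProjectiveDimensionLE T 1 := hasProjectiveDimensionLE_one_of_retract hM i p hpi
  let f : I₀ × I₀ →ₗ[Λ] T := p ∘ₗ LinearMap.prodMap LinearMap.id d.rangeRestrict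
  have hf : Function.Surjective f :=
    hp.comp (Function.Surjective.prodMap Function.surjective_id d.surjective_rangeRestrict)
  have hinj : Module.Injective Λ (I₀ × I₀) := injective_prod I₀ I₀
  have hinj' : Module.Injective Λ (I₀ × I₁) := injective_prod I₀ I₁
  refine ⟨T, ⟨Module.Finite.of_surjective p hp, hbasic, hT,
    subsingleton_ext_one_of_injective_surjective hT f hf, I₀, ModuleCat.of Λ C, ι,
    d.rangeRestrict, ?_, ?_, hι, ?_, d.surjective_rangeRestrict⟩, ?_⟩
  · exact hadd.of_retract (X := M) (LinearMap.inl Λ I₀ C) (LinearMap.fst Λ I₀ C) rfl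
  · exact hadd.of_retract (X := M) (LinearMap.inr Λ I₀ C) (LinearMap.snd Λ I₀ C) rfl
  · intro x
    rw [← hex x]
    exact Subtype.ext_iff
  · exact isInC_of_surjective_of_injective (ModuleCat.of Λ (I₀ × I₀)) (ModuleCat.of Λ (I₀ × I₁))
      f hf (LinearMap.prodMap LinearMap.id C.subtype ∘ₗ i)
      ((Function.Injective.prodMap Function.injective_id C.injective_subtype).comp hi)

end DominantDimension

/-! ### The lower right corner of an `A[E]`-module. -/

section MatrixCorners

variable {A E : Type u} [Ring A] [AddCommGroup E] [Module A E]

namespace EndExtension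

variable (E) in
/-- The matrix with lower right entry `a` and all other entries zero. -/
def lowerRight (a : A) : EndExtension A E := ⟨0, 0, a⟩

variable (A) in
/-- The matrix with lower left entry `e` and all other entries zero. -/
def lowerLeft (e : E) : EndExtension A E := ⟨0, e, 0⟩

lemma lowerRight_add (a b : A) : lowerRight E (a + b) = lowerRight E a + lowerRight E b := by
  ext <;> simp [lowerRight]

lemma lowerRight_zero : lowerRight E (0 : A) = 0 := rfl

lemma lowerLeft_add (e e' : E) : lowerLeft A (e + e') = lowerLeft A e + lowerLeft A e' := by
  ext <;> simp [lowerLeft]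

lemma lowerRight_mul (a b : A) : lowerRight E a * lowerRight E b = lowerRight E (a * b) := by
  ext <;> simp [lowerRight]

lemma lowerRight_mul_lowerLeft (a : A) (e : E) :
    lowerRight E a * lowerLeft A e = lowerLeft A (a • e) := by
  ext <;> simp [lowerRight, lowerLeft]

lemma mul_lowerRight (t : EndExtension A E) (a : A) :
    t * lowerRight E a = lowerRight E (t.s * a) := by
  ext <;> simp [lowerRight]

lemma lowerRight_one_mul (t : EndExtension A E) :
    lowerRight E (1 : A) * t = lowerLeft A t.m + lowerRight E t.s := by
  ext <;> simp [lowerRight, lowerLeft]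

lemma lowerLeft_mul (e : E) (t : EndExtension A E) :
    lowerLeft A e * t = lowerLeft A (t.r.unop e) := by
  ext <;> simp [lowerLeft, endOp_smul_def]

variable (X : Type u) [AddCommGroup X] [Module (EndExtension A E) X]

variable (A E) in
/-- The `A`-module `V` of a triple `(W, V, f)`, cut out of an `A[E]`-module by the lower right
idempotent. -/
def rightPart : AddSubgroup X where
  carrier := {x | lowerRight E (1 : A) • x = x}
  zero_mem' := smul_zero _
  add_mem' hx hy := by
    rw [Set.mem_ofPred_eq] at *
    rw [smul_add, hx, hy]
  neg_mem' hx := by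
    rw [Set.mem_ofPred_eq] at *
    rw [smul_neg, hx]

variable {X}

lemma lowerRight_smul_mem (a : A) (x : X) : lowerRight E a • x ∈ rightPart A E X := by
  change lowerRight E (1 : A) • lowerRight E a • x = lowerRight E a • x
  rw [← mul_smul, lowerRight_mul, one_mul]

lemma lowerLeft_smul_mem (e : E) (x : X) : lowerLeft A e • x ∈ rightPart A E X := by
  change lowerRight E (1 : A) • lowerLeft A e • x = lowerLeft A e • x
  rw [← mul_smul, lowerRight_mul_lowerLeft, one_smul]

/-- The embedding `lowerRight E` of `A` is not unital: it sends `1` to an idempotent. The action is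
unital exactly on the elements fixed by that idempotent. -/
instance : Module A (rightPart A E X) where
  smul a x := ⟨lowerRight E a • (x : X), lowerRight_smul_mem a _⟩
  one_smul x := Subtype.ext x.2
  mul_smul a b x := Subtype.ext (by
    change lowerRight E (a * b) • (x : X) = lowerRight E a • lowerRight E b • (x : X)
    rw [← mul_smul, lowerRight_mul])
  smul_zero a := Subtype.ext (smul_zero (lowerRight E a))
  smul_add a x y := Subtype.ext (smul_add (lowerRight E a) (x : X) (y : X))
  add_smul a b x := Subtype.ext (by
    change lowerRight E (a + b) • (x : X) = lowerRight E a • (x : X) + lowerRight E b • (x : X)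
    rw [lowerRight_add, add_smul])
  zero_smul x := Subtype.ext (by
    change lowerRight E (0 : A) • (x : X) = 0
    rw [lowerRight_zero, zero_smul])

@[simp] lemma coe_smul_rightPart (a : A) (x : rightPart A E X) :
    ((a • x : rightPart A E X) : X) = lowerRight E a • (x : X) := rfl

/-- The second column of a lower triangular matrix has only its lower entry, so `A[E]` acts on this
part through `A`. Thus `A`-linear maps into it give `A[E]`-linear maps out of `(0, V, 0)`. -/
lemma smul_of_mem_rightPart (t : EndExtension A E) (x : rightPart A E X) :
    t • (x : X) = lowerRight E t.s • (x : X) := by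
  have hx : lowerRight E (1 : A) • (x : X) = x := x.2
  conv_lhs => rw [← hx, ← mul_smul, mul_lowerRight, mul_one]

/-- Multiplication by a lower left entry. -/
def leftAction (x : X) : E →ₗ[A] rightPart A E X where
  toFun e := ⟨lowerLeft A e • x, lowerLeft_smul_mem e x⟩
  map_add' e e' := Subtype.ext (by simp [lowerLeft_add, add_smul])
  map_smul' a e := Subtype.ext (by
    simp only [RingHom.id_apply, coe_smul_rightPart]
    rw [← mul_smul, lowerRight_mul_lowerLeft])

variable {Y : Type u} [AddCommGroup Y] [Module (EndExtension A E) Y]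

/-- The restriction of an `A[E]`-linear map. -/
def rightPartMap (f : X →ₗ[EndExtension A E] Y) : rightPart A E X →ₗ[A] rightPart A E Y where
  toFun x := ⟨f x, by
    change lowerRight E (1 : A) • f x = f x
    rw [← f.map_smul]
    exact congrArg f x.2⟩
  map_add' x y := Subtype.ext (f.map_add x y)
  map_smul' a x := Subtype.ext (f.map_smul (lowerRight E a) (x : X))

end EndExtension

end MatrixCorners

/-! ### The functor `V ↦ (0, V, 0)`, left adjoint to the corner. -/

section RightTriples

variable {A E : Type u} [Ring A] [AddCommGroup E] [Module A E]

open EndExtension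

variable (E) in
/-- The `A[E]`-module of the triple `(0, V, 0)`. -/
abbrev RightCarrier (V : ModuleCat.{u} A) : Type u :=
  (ModuleTriple.ofRight (Module.End A E)ᵐᵒᵖ E V).Carrier

namespace RightCarrier

variable {V V' : ModuleCat.{u} A}

variable (E) in
/-- The element `(0, v)`. -/
def mk (v : V) : RightCarrier E V := (PUnit.unit, v)

/-- The component in `V`. -/
def val (x : RightCarrier E V) : V := x.2

@[ext] lemma ext {x y : RightCarrier E V} (h : x.val = y.val) : x = y := Prod.ext rfl h

@[simp] lemma val_mk (v : V) : (mk E v).val = v := rfl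
@[simp] lemma mk_val (x : RightCarrier E V) : mk E x.val = x := rfl
@[simp] lemma val_add (x y : RightCarrier E V) : (x + y).val = x.val + y.val := rfl
@[simp] lemma val_zero : (0 : RightCarrier E V).val = 0 := rfl
@[simp] lemma val_smul (t : EndExtension A E) (x : RightCarrier E V) :
    (t • x).val = t.s • x.val := zero_add _

variable (E) in
/-- The functor `V ↦ (0, V, 0)` on linear maps. -/
def map (f : V →ₗ[A] V') : RightCarrier E V →ₗ[EndExtension A E] RightCarrier E V' where
  toFun x := mk E (f x.val)
  map_add' x y := by ext; simp
  map_smul' t x := by ext; simp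

@[simp] lemma map_apply (f : V →ₗ[A] V') (x : RightCarrier E V) : map E f x = mk E (f x.val) := rfl

/-- The functor `V ↦ (0, V, 0)` is full. -/
def unmap (g : RightCarrier E V →ₗ[EndExtension A E] RightCarrier E V') : V →ₗ[A] V' where
  toFun v := (g (mk E v)).val
  map_add' v w := by
    rw [← val_add, ← map_add]
    rfl
  map_smul' a v := by
    have h : mk E (a • v) = lowerRight E a • mk E v := by ext; simp [lowerRight]
    rw [h, map_smul, val_smul]
    rfl

@[simp] lemma unmap_apply (g : RightCarrier E V →ₗ[EndExtension A E] RightCarrier E V') (v : V) :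
    unmap g v = (g (mk E v)).val := rfl

lemma map_injective {f : V →ₗ[A] V'} (hf : Function.Injective f) :
    Function.Injective (map E f) := fun x y h => by
  ext
  exact hf (congrArg val h)

lemma map_surjective {f : V →ₗ[A] V'} (hf : Function.Surjective f) :
    Function.Surjective (map E f) := fun y => by
  obtain ⟨v, hv⟩ := hf y.val
  exact ⟨mk E v, by ext; simp [hv]⟩

variable (E) in
/-- The functor `V ↦ (0, V, 0)` on isomorphisms. -/
def mapEquiv (e : V ≃ₗ[A] V') : RightCarrier E V ≃ₗ[EndExtension A E] RightCarrier E V' :=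
  LinearEquiv.ofLinearMap (map E e.toLinearMap) (map E e.symm.toLinearMap)
    (by ext; simp) (by ext; simp)

variable (E) in
/-- The functor `V ↦ (0, V, 0)` preserves products. -/
def piEquiv {ι : Type} (X : ι → ModuleCat.{u} A) :
    RightCarrier E (ModuleCat.of A (∀ i, X i)) ≃ₗ[EndExtension A E]
      ∀ i, RightCarrier E (X i) where
  toFun x i := mk E (x.val i)
  invFun y := mk E (V := ModuleCat.of A (∀ i, X i)) fun i => (y i).val
  map_add' x y := rfl
  map_smul' t x := by
    funext i
    ext
    simp only [RingHom.id_apply, val_mk, Pi.smul_apply, val_smul]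
  left_inv x := rfl
  right_inv y := rfl

lemma indecomposable (hV : Indecomposable V) :
    Indecomposable (ModuleCat.of (EndExtension A E) (RightCarrier E V)) := by
  obtain ⟨h1, h2⟩ := indecomposable_iff.1 hV
  refine indecomposable_iff.2 ⟨?_, fun e he => ?_⟩
  · obtain ⟨v, w, h⟩ := h1
    exact ⟨mk E v, mk E w, fun h' => h (congrArg val h')⟩
  · let g : RightCarrier E V →ₗ[EndExtension A E] RightCarrier E V := e
    have hg : ∀ x, g (g x) = g x := LinearMap.congr_fun he
    refine (h2 (unmap g) ?_).imp (fun h => ?_) fun h => ?_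
    · ext v
      simp [hg]
    · refine LinearMap.ext fun x => ?_
      exact RightCarrier.ext (LinearMap.congr_fun h (val x))
    · refine LinearMap.ext fun x => ?_
      exact RightCarrier.ext (LinearMap.congr_fun h (val x))

lemma linearEquiv_of_linearEquiv
    (e : RightCarrier E V ≃ₗ[EndExtension A E] RightCarrier E V') : Nonempty (V ≃ₗ[A] V') :=
  ⟨LinearEquiv.ofLinearMap (unmap e.toLinearMap) (unmap e.symm.toLinearMap)
    (by ext; simp) (by ext; simp)⟩

lemma finite [Module.Finite A V] : Module.Finite (EndExtension A E) (RightCarrier E V) := by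
  obtain ⟨S, hS⟩ := (Module.Finite.fg_top : (⊤ : Submodule A V).FG)
  classical
  refine ⟨⟨S.image (mk E), eq_top_iff.2 fun x _ => ?_⟩⟩
  have key : ∀ v : V, mk E v ∈ Submodule.span (EndExtension A E)
      ((S.image (mk E) : Finset (RightCarrier E V)) : Set (RightCarrier E V)) := fun v => by
    have hv : v ∈ Submodule.span A (S : Set V) := hS ▸ Submodule.mem_top
    induction hv using Submodule.span_induction with
    | mem v hv => exact Submodule.subset_span (by simpa using ⟨v, hv, rfl⟩)
    | zero => exact Submodule.zero_mem _
    | add v w _ _ h1 h2 => exact Submodule.add_mem _ h1 h2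
    | smul a v _ h =>
      have h' : mk E (a • v) = lowerRight E a • mk E v := by ext; simp [lowerRight]
      rw [h']
      exact Submodule.smul_mem _ _ h
  exact key x.val

/-- Maps `(0, V, 0) → X` are `A`-linear maps from `V` to the corner of `X`, and cutting out the
corner keeps surjections surjective. Hence a splitting is found over `A`. -/
lemma projective [Module.Projective A V] :
    Module.Projective (EndExtension A E) (RightCarrier E V) := by
  refine Module.Projective.of_lifting_property'' fun f hf => ?_
  let φ : rightPart A E (RightCarrier E V →₀ EndExtension A E) →ₗ[A] V :=
    { toFun := fun x => (f x).val
      map_add' := fun x y => by simp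
      map_smul' := fun a x => by
        rw [coe_smul_rightPart, map_smul, val_smul]
        rfl }
  have hφ : Function.Surjective φ := fun v => by
    obtain ⟨x, hx⟩ := hf (mk E v)
    refine ⟨⟨lowerRight E (1 : A) • x, lowerRight_smul_mem 1 x⟩, ?_⟩
    change (f (lowerRight E (1 : A) • x)).val = v
    rw [map_smul, hx, val_smul]
    exact one_smul A v
  obtain ⟨h, hh⟩ := Module.projective_lifting_property φ LinearMap.id hφ
  refine ⟨{ toFun := fun x => h x.val, map_add' := fun x y => by simp, map_smul' := fun t x => ?_ },
    ?_⟩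
  · rw [val_smul, map_smul, coe_smul_rightPart, RingHom.id_apply, ← smul_of_mem_rightPart]
  · refine LinearMap.ext fun x => RightCarrier.ext ?_
    exact LinearMap.congr_fun hh x.val

/-- `V ↦ (0, V, 0)` does not raise the projective dimension beyond one. -/
lemma hasProjectiveDimensionLE_one (hV : HasProjectiveDimensionLE V 1) :
    HasProjectiveDimensionLE (ModuleCat.of (EndExtension A E) (RightCarrier E V)) 1 := by
  let P := ModuleCat.of A (V →₀ A)
  let π : P →ₗ[A] V := Finsupp.linearCombination A id
  have hπ : Function.Surjective π := Finsupp.linearCombination_id_surjective A V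
  have hP : Module.Projective A P := inferInstanceAs (Module.Projective A (V →₀ A))
  have hK : Module.Projective A (LinearMap.ker π) :=
    (hasProjectiveDimensionLE_one_iff π hπ).1 hV
  have := RightCarrier.projective (E := E) (V := P)
  rw [hasProjectiveDimensionLE_one_iff (map E π) (map_surjective hπ)]
  have := RightCarrier.projective (E := E) (V := ModuleCat.of A (LinearMap.ker π))
  let e : RightCarrier E (ModuleCat.of A (LinearMap.ker π)) ≃ₗ[EndExtension A E]
      LinearMap.ker (map E π) :=
    LinearEquiv.ofBijective
      ((map E (V := ModuleCat.of A (LinearMap.ker π)) (LinearMap.ker π).subtype).codRestrict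
        (LinearMap.ker (map E π)) fun x => RightCarrier.ext x.val.2)
      ⟨fun x y h => map_injective (E := E) (V := ModuleCat.of A (LinearMap.ker π))
          (LinearMap.ker π).injective_subtype (Subtype.ext_iff.1 h),
        fun y => ⟨mk E (V := ModuleCat.of A (LinearMap.ker π)) ⟨y.1.val, congrArg val y.2⟩, rfl⟩⟩
  exact Module.Projective.of_equiv e

end RightCarrier

end RightTriples

/-! ### The functor `V ↦ (Hom(E, V), V, η)`, right adjoint to the corner. -/

section EvaluationTriples

variable {A E : Type u} [Ring A] [AddCommGroup E] [Module A E]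

open EndExtension

variable (E) in
/-- The `A[E]`-module of the triple `(Hom_A(E, V), V, η)`. -/
abbrev EvalCarrier (V : ModuleCat.{u} A) : Type u := (evalTriple E V).Carrier

namespace EvalCarrier

variable {V V' : ModuleCat.{u} A}

/-- The element `(f, v)`. -/
def mk (f : E →ₗ[A] V) (v : V) : EvalCarrier E V := (f, v)

/-- The component in `Hom_A(E, V)`. -/
def hom (x : EvalCarrier E V) : E →ₗ[A] V := x.1

/-- The component in `V`. -/
def val (x : EvalCarrier E V) : V := x.2

@[ext] lemma ext {x y : EvalCarrier E V} (h : x.hom = y.hom) (h' : x.val = y.val) : x = y :=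
  Prod.ext h h'

@[simp] lemma hom_mk (f : E →ₗ[A] V) (v : V) : (mk f v).hom = f := rfl
@[simp] lemma val_mk (f : E →ₗ[A] V) (v : V) : (mk f v).val = v := rfl
@[simp] lemma hom_add (x y : EvalCarrier E V) : (x + y).hom = x.hom + y.hom := rfl
@[simp] lemma val_add (x y : EvalCarrier E V) : (x + y).val = x.val + y.val := rfl
@[simp] lemma hom_smul (t : EndExtension A E) (x : EvalCarrier E V) :
    (t • x).hom = x.hom ∘ₗ t.r.unop := rfl
@[simp] lemma val_smul (t : EndExtension A E) (x : EvalCarrier E V) :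
    (t • x).val = x.hom t.m + t.s • x.val := rfl

lemma lowerLeft_smul (e : E) (x : EvalCarrier E V) : lowerLeft A e • x = mk 0 (x.hom e) := by
  ext <;> simp [lowerLeft]

lemma lowerRight_smul (a : A) (x : EvalCarrier E V) :
    lowerRight E a • x = mk 0 (a • x.val) := by
  ext <;> simp [lowerRight]

/-- The functor `V ↦ (Hom_A(E, V), V, η)` is full. -/
def unmap (g : EvalCarrier E V →ₗ[EndExtension A E] EvalCarrier E V') : V →ₗ[A] V' where
  toFun v := (g (mk 0 v)).val
  map_add' v w := by
    rw [← val_add, ← map_add]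
    congr 2
    ext <;> simp
  map_smul' a v := by
    have h : (mk 0 (a • v) : EvalCarrier E V) = lowerRight E a • mk 0 v := by
      rw [lowerRight_smul, val_mk]
    rw [h, map_smul, lowerRight_smul]
    rfl

lemma unmap_apply (g : EvalCarrier E V →ₗ[EndExtension A E] EvalCarrier E V') (v : V) :
    unmap g v = (g (mk 0 v)).val := rfl

/-- A component in `Hom(E, V)` is determined by the action of the lower left entries, with which `g`
commutes. So `g` is determined by its effect on `V`. -/
lemma hom_apply (g : EvalCarrier E V →ₗ[EndExtension A E] EvalCarrier E V')
    (x : EvalCarrier E V) : (g x).hom = unmap g ∘ₗ x.hom := by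
  ext e
  have h := congrArg val (lowerLeft_smul e (g x))
  rw [← map_smul, lowerLeft_smul] at h
  exact h.symm

lemma val_apply (g : EvalCarrier E V →ₗ[EndExtension A E] EvalCarrier E V')
    (x : EvalCarrier E V) : (g x).val = unmap g x.val := by
  have h := congrArg val (lowerRight_smul (1 : A) (g x))
  rw [← map_smul, lowerRight_smul, one_smul, one_smul] at h
  exact h.symm

lemma indecomposable (hV : Indecomposable V) :
    Indecomposable (ModuleCat.of (EndExtension A E) (EvalCarrier E V)) := by
  obtain ⟨h1, h2⟩ := indecomposable_iff.1 hV
  refine indecomposable_iff.2 ⟨?_, fun e he => ?_⟩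
  · obtain ⟨v, w, h⟩ := h1
    exact ⟨mk 0 v, mk 0 w, fun h' => h (congrArg val h')⟩
  · let g : EvalCarrier E V →ₗ[EndExtension A E] EvalCarrier E V := e
    have hg : ∀ x, g (g x) = g x := LinearMap.congr_fun he
    refine (h2 (unmap g) ?_).imp (fun h => ?_) fun h => ?_
    · ext v
      rw [LinearMap.comp_apply, unmap_apply g v, ← val_apply, hg]
    · refine LinearMap.ext fun x => EvalCarrier.ext ?_ ?_
      · exact (hom_apply g x).trans (by rw [h, LinearMap.zero_comp]; rfl)
      · exact (val_apply g x).trans (by rw [h]; rfl)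
    · refine LinearMap.ext fun x => EvalCarrier.ext ?_ ?_
      · exact (hom_apply g x).trans (by rw [h, LinearMap.id_comp]; rfl)
      · exact (val_apply g x).trans (by rw [h]; rfl)

lemma linearEquiv_of_linearEquiv
    (e : EvalCarrier E V ≃ₗ[EndExtension A E] EvalCarrier E V') : Nonempty (V ≃ₗ[A] V') :=
  ⟨LinearEquiv.ofLinearMap (unmap e.toLinearMap) (unmap e.symm.toLinearMap)
    (by
      ext v
      rw [LinearMap.comp_apply, unmap_apply e.symm.toLinearMap, ← val_apply]
      simp)
    (by
      ext v
      rw [LinearMap.comp_apply, unmap_apply e.toLinearMap, ← val_apply]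
      simp)⟩

/-- The functor `V ↦ (Hom_A(E, V), V, η)` preserves injectives. -/
lemma injective [Module.Injective A V] :
    Module.Injective (EndExtension A E) (EvalCarrier E V) where
  out X Y _ _ _ _ f hf g := by
    let φ : rightPart A E X →ₗ[A] V :=
      { toFun := fun x => (g x).val
        map_add' := fun x y => by simp
        map_smul' := fun a x => by
          rw [coe_smul_rightPart, map_smul, lowerRight_smul]
          rfl }
    obtain ⟨ψ, hψ⟩ := Module.Injective.out (rightPartMap f)
      (fun x y h => Subtype.ext (hf (congrArg Subtype.val h))) φ
    -- This is the adjoint of `ψ`: the first component records `e ↦ ψ (e · y)`, the second is `ψ` on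
    -- the corner component of `y`.
    refine ⟨{ toFun := fun y => mk (ψ ∘ₗ leftAction y)
                (ψ ⟨lowerRight E (1 : A) • y, lowerRight_smul_mem 1 y⟩)
              map_add' := fun y z => ?_
              map_smul' := fun t y => ?_ }, fun x => ?_⟩
    · ext
      · simp only [hom_mk, hom_add, LinearMap.comp_apply, LinearMap.add_apply, ← map_add]
        exact congrArg ψ (Subtype.ext (smul_add _ y z))
      · simp only [val_mk, val_add, ← map_add]
        exact congrArg ψ (Subtype.ext (smul_add _ y z))
    · ext e
      · simp only [hom_mk, hom_smul, LinearMap.comp_apply, RingHom.id_apply]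
        refine congrArg ψ (Subtype.ext ?_)
        change lowerLeft A e • t • y = lowerLeft A (t.r.unop e) • y
        rw [← mul_smul, lowerLeft_mul]
      · simp only [val_mk, val_smul, hom_mk, LinearMap.comp_apply, RingHom.id_apply, ← map_add,
          ← map_smul]
        refine congrArg ψ (Subtype.ext ?_)
        change lowerRight E (1 : A) • t • y
          = lowerLeft A t.m • y + lowerRight E t.s • lowerRight E (1 : A) • y
        rw [← mul_smul, lowerRight_one_mul, add_smul, ← mul_smul, lowerRight_mul, mul_one]
    · ext e
      · have h := hψ (leftAction x e)
        have h1 : rightPartMap f (leftAction x e) = leftAction (f x) e :=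
          Subtype.ext (f.map_smul (lowerLeft A e) x)
        rw [h1] at h
        refine h.trans ?_
        change (g (lowerLeft A e • x)).val = (g x).hom e
        rw [map_smul, lowerLeft_smul, val_mk]
      · have h := hψ ⟨lowerRight E (1 : A) • x, lowerRight_smul_mem 1 x⟩
        have h1 : rightPartMap f ⟨lowerRight E (1 : A) • x, lowerRight_smul_mem 1 x⟩ =
            ⟨lowerRight E (1 : A) • f x, lowerRight_smul_mem 1 (f x)⟩ :=
          Subtype.ext (f.map_smul (lowerRight E (1 : A)) x)
        rw [h1] at h
        refine h.trans ?_
        change (g (lowerRight E (1 : A) • x)).val = (g x).val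
        rw [map_smul, lowerRight_smul, val_mk, one_smul]

/-- The map `A[E] → (Hom_A(E, V), V, η)` with `1 ↦ (p, 0)`. -/
def ofHom (p : E →ₗ[A] V) : EndExtension A E →ₗ[EndExtension A E] EvalCarrier E V :=
  LinearMap.toSpanSingleton _ _ (mk p 0)

@[simp] lemma val_ofHom (p : E →ₗ[A] V) (t : EndExtension A E) : (ofHom p t).val = p t.m := by
  change p t.m + t.s • (0 : V) = p t.m
  rw [smul_zero, add_zero]

/-- The map `(Hom_A(E, V), V, η) → A[E]` induced by a homomorphism `V → E`. -/
def toRing (i : V →ₗ[A] E) : EvalCarrier E V →ₗ[EndExtension A E] EndExtension A E where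
  toFun x := ⟨MulOpposite.op (i ∘ₗ x.hom), i x.val, 0⟩
  map_add' x y := by
    ext
    · exact congrArg MulOpposite.op (LinearMap.comp_add _ _ _)
    · exact map_add i _ _
    · exact (add_zero 0).symm
  map_smul' t x := by
    ext
    · rfl
    · simp [endOp_smul_def]
    · exact (mul_zero t.s).symm

lemma ofHom_comp_toRing {i : V →ₗ[A] E} {p : E →ₗ[A] V} (h : p ∘ₗ i = LinearMap.id) :
    ofHom p ∘ₗ toRing i = LinearMap.id := by
  refine LinearMap.ext fun x => EvalCarrier.ext ?_ ?_
  · change p ∘ₗ i ∘ₗ x.hom = x.hom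
    rw [← LinearMap.comp_assoc, h, LinearMap.id_comp]
  · exact (val_ofHom p _).trans (LinearMap.congr_fun h x.val)

/-- For `V = E` this is the first column of `A[E]`; a summand of `E` gives a summand of that column.
-/
lemma projective {i : V →ₗ[A] E} {p : E →ₗ[A] V} (h : p ∘ₗ i = LinearMap.id) :
    Module.Projective (EndExtension A E) (EvalCarrier E V) :=
  Module.Projective.of_split _ _ (ofHom_comp_toRing h)

lemma finite {i : V →ₗ[A] E} {p : E →ₗ[A] V} (h : p ∘ₗ i = LinearMap.id) :
    Module.Finite (EndExtension A E) (EvalCarrier E V) :=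
  Module.Finite.of_surjective (ofHom p) fun x =>
    ⟨toRing i x, LinearMap.congr_fun (ofHom_comp_toRing h) x⟩

/-- If `Hom_A(E, V) = 0`, then `(Hom_A(E, V), V, η) = (0, V, 0)`. -/
def rightEquiv (h : ∀ f : E →ₗ[A] V, f = 0) :
    RightCarrier E V ≃ₗ[EndExtension A E] EvalCarrier E V where
  toFun x := mk 0 x.val
  invFun x := RightCarrier.mk E x.val
  map_add' x y := by ext <;> simp
  map_smul' t x := by ext <;> simp
  left_inv x := rfl
  right_inv x := by ext <;> simp [h x.hom]

end EvalCarrier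

/-- Since `f = p ∘ (i ∘ f)` and `i ∘ f` is an endomorphism of `E`, it moves across the tensor sign:
`e ⊗ f = i (f e) ⊗ p`. So `v ↦ i v ⊗ p` is inverse to `η`. -/
lemma evalEta_bijective {V : ModuleCat.{u} A} {i : V →ₗ[A] E} {p : E →ₗ[A] V}
    (h : p ∘ₗ i = LinearMap.id) : Function.Bijective (evalEta E V) := by
  let tm : E → (E →ₗ[A] V) → BimoduleTensor (Module.End A E)ᵐᵒᵖ A E (homEndOp E V) := fun e f =>
    BimoduleTensor.tmul (Module.End A E)ᵐᵒᵖ A E (W := homEndOp E V) e f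
  have key : ∀ e f, tm e f = tm (i (f e)) p := fun e f => by
    have h1 := BimoduleTensor.tmul_smul (Module.End A E)ᵐᵒᵖ A E (W := homEndOp E V) e
      (MulOpposite.op (i ∘ₗ f)) p
    have h2 : (MulOpposite.op (i ∘ₗ f) : (Module.End A E)ᵐᵒᵖ) • (show homEndOp E V from p) =
        f := by
      change p ∘ₗ i ∘ₗ f = f
      rw [← LinearMap.comp_assoc, h, LinearMap.id_comp]
    rw [h2] at h1
    exact h1.symm
  have hall : ∀ t, t = tm (i (evalEta E V t)) p := fun t => by
    obtain ⟨t, rfl⟩ := Submodule.Quotient.mk_surjective _ t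
    induction t using TensorProduct.induction_on with
    | zero =>
      rw [Submodule.Quotient.mk_zero, map_zero, map_zero]
      exact (BimoduleTensor.zero_tmul _ _ _ _).symm
    | tmul e f => exact key e f
    | add x y hx hy =>
      rw [Submodule.Quotient.mk_add, map_add, map_add]
      exact (congrArg₂ (· + ·) hx hy).trans (BimoduleTensor.add_tmul _ _ _ _ _ _).symm
  refine ⟨fun x y hxy => ?_, fun v => ⟨tm (i v) p, LinearMap.congr_fun h v⟩⟩
  rw [hall x, hall y, hxy]

end EvaluationTriples

/-! ### Chain conditions for `A[E]`. -/

section ArtinAlgebra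

/-- `A[E]` is an artinian ring when `A` is an artin algebra and `E` is finitely generated. -/
lemma isArtinianRing_endExtension (k : Type*) [CommRing k] [IsArtinianRing k] {A : Type u} [Ring A]
    [Algebra k A] [Module.Finite k A] (E : Type u) [AddCommGroup E] [Module A E]
    [Module.Finite A E] : IsArtinianRing (EndExtension A E) := by
  let _ : Module k E := Module.compHom E (algebraMap k A)
  have : IsScalarTower k A E := ⟨fun c a e => by
    rw [Algebra.smul_def, mul_smul]
    rfl⟩
  have : SMulCommClass A k E := IsScalarTower.to_smulCommClass'
  have : Module.Finite k E := Module.Finite.trans A E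
  -- It embeds in `End_k(E)`, which is finite over the noetherian ring `k`.
  have : Module.Finite k (Module.End A E) :=
    Module.Finite.of_injective (LinearMap.restrictScalarsₗ k A E E k)
      (LinearMap.restrictScalars_injective k)
  let φ : k →+* EndExtension A E :=
    { toFun := fun c => ⟨MulOpposite.op (algebraMap k (Module.End A E) c), 0, algebraMap k A c⟩
      map_one' := by ext <;> simp
      map_mul' := fun a b => by
        ext
        · simp [mul_comm a b]
        · simp
        · simp
      map_zero' := by ext <;> simp
      map_add' := fun a b => by
        ext <;> simp }
  let _ : Module k (EndExtension A E) := Module.compHom _ φ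
  have : IsScalarTower k (EndExtension A E) (EndExtension A E) :=
    ⟨fun c x y => mul_assoc (φ c) x y⟩
  let ρ : (Module.End A E × E × A) →ₗ[k] EndExtension A E :=
    { toFun := fun x => ⟨MulOpposite.op x.1, x.2.1, x.2.2⟩
      map_add' := fun x y => rfl
      map_smul' := fun c x => by
        change _ = φ c * _
        ext
        · simp only [φ, RingHom.coe_mk, MonoidHom.coe_mk, OneHom.coe_mk, TriangularRing.mul_r]
          rw [← MulOpposite.op_mul, ← Algebra.commutes, ← Algebra.smul_def]
          rfl
        · simp [φ]
        · simp [φ, Algebra.smul_def] }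
  have : Module.Finite k (EndExtension A E) :=
    Module.Finite.of_surjective ρ fun x => ⟨(x.r.unop, x.m, x.s), rfl⟩
  exact isArtinian_of_tower k inferInstance

end ArtinAlgebra

/-! ### The extended tilting module over `A[E]`. -/

section ExtendedTilting

variable {A : Type u} [Ring A]

/-- Lower left entries annihilate `(0, W, 0)`, but `i v` sends `(p, 0)` to `(0, v)`. This separates
the two kinds of summands in the basic decomposition. -/
lemma isEmpty_rightCarrier_linearEquiv_evalCarrier {E : Type u} [AddCommGroup E] [Module A E]
    {V W : ModuleCat.{u} A} [Nontrivial V] {i : V →ₗ[A] E} {p : E →ₗ[A] V}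
    (h : p ∘ₗ i = LinearMap.id) :
    IsEmpty (RightCarrier E W ≃ₗ[EndExtension A E] EvalCarrier E V) := by
  refine ⟨fun e => ?_⟩
  obtain ⟨v, hv⟩ := exists_ne (0 : V)
  have h1 : EndExtension.lowerLeft A (i v) • e.symm (EvalCarrier.mk p 0) = 0 := by
    ext
    rw [RightCarrier.val_smul]
    exact zero_smul A _
  rw [← map_smul, EvalCarrier.lowerLeft_smul, EvalCarrier.hom_mk, LinearEquiv.map_eq_zero_iff] at h1
  exact hv ((LinearMap.congr_fun h v).symm.trans (congrArg EvalCarrier.val h1))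

variable {r : ℕ} (I : Fin r → ModuleCat.{u} A)

lemma proj_comp_single_eq_id (i : Fin r) :
    (LinearMap.proj i : (∀ j, I j) →ₗ[A] I i) ∘ₗ LinearMap.single A (fun j => I j) i =
      LinearMap.id := by
  ext x
  simp

/-- The projective-injective part `⨁ᵢ (Hom_A(E, Iᵢ), Iᵢ, ηᵢ)` of the extended tilting module. -/
abbrev EvalSum : Type u := ∀ i, EvalCarrier (∀ j, I j) (I i)

lemma evalSum_finite : Module.Finite (EndExtension A (∀ j, I j)) (EvalSum I) := by
  have := fun i => EvalCarrier.finite (proj_comp_single_eq_id I i)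
  infer_instance

lemma evalSum_projective : Module.Projective (EndExtension A (∀ j, I j)) (EvalSum I) := by
  have := fun i => EvalCarrier.projective (proj_comp_single_eq_id I i)
  exact projective_pi _

lemma evalSum_injective (hinj : ∀ i, Injective (I i)) :
    Module.Injective (EndExtension A (∀ j, I j)) (EvalSum I) := by
  have := fun i => (injective_object_iff _).1 (hinj i)
  have := fun i => EvalCarrier.injective (E := ∀ j, I j) (V := I i)
  infer_instance

lemma extendedTilting_isBasicModule (hind : ∀ i, Indecomposable (I i))
    (hne : ∀ i j, Nonempty (I i ≃ₗ[A] I j) → i = j) {T : ModuleCat.{u} A}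
    (hT : IsBasicModule T) : IsBasicModule (extendedTilting I T) := by
  obtain ⟨n, X, hX, hXne, ⟨e⟩⟩ := hT
  let Z : Fin n ⊕ Fin r → ModuleCat.{u} (EndExtension A (∀ j, I j)) :=
    Sum.elim (fun i => ModuleCat.of _ (RightCarrier (∀ j, I j) (X i)))
      (fun i => ModuleCat.of _ (EvalCarrier (∀ j, I j) (I i)))
  refine isBasicModule_of_linearEquiv_pi Z ?_ ?_ ?_
  · rintro (i | i)
    · exact RightCarrier.indecomposable (hX i)
    · exact EvalCarrier.indecomposable (hind i)
  · rintro (i | i) (j | j) ⟨d⟩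
    · exact congrArg Sum.inl (hXne i j (RightCarrier.linearEquiv_of_linearEquiv d))
    · have := (hind j).nontrivial_module
      exact ((isEmpty_rightCarrier_linearEquiv_evalCarrier
        (proj_comp_single_eq_id I j)).false d).elim
    · have := (hind i).nontrivial_module
      exact ((isEmpty_rightCarrier_linearEquiv_evalCarrier
        (proj_comp_single_eq_id I i)).false d.symm).elim
    · exact congrArg Sum.inr (hne i j (EvalCarrier.linearEquiv_of_linearEquiv d))
  · exact (LinearEquiv.prodCongr
      (RightCarrier.mapEquiv (∀ j, I j) (V' := ModuleCat.of A (∀ i, X i)) e ≪≫ₗ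
        RightCarrier.piEquiv (∀ j, I j) X)
      (LinearEquiv.refl (EndExtension A (∀ j, I j)) (EvalSum I))) ≪≫ₗ
      (LinearEquiv.sumPiEquivProdPi (EndExtension A (∀ j, I j)) (Fin n) (Fin r)
        (fun i => (Z i : Type u))).symm

/-- The tautological embedding `A[E] → (0, T₀, 0) ⊕ ⨁ᵢ (Hom_A(E, Iᵢ), Iᵢ, ηᵢ)` induced by a map
`A → T₀`. -/
def extendedEmbedding {T₀ : ModuleCat.{u} A} (f : A →ₗ[A] T₀) :
    EndExtension A (∀ j, I j) →ₗ[EndExtension A (∀ j, I j)]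
      RightCarrier (∀ j, I j) T₀ × EvalSum I :=
  (LinearMap.toSpanSingleton _ _ (RightCarrier.mk (∀ j, I j) (f 1))).prod
    (LinearMap.pi fun i => EvalCarrier.ofHom (LinearMap.proj i))

lemma extendedEmbedding_val {T₀ : ModuleCat.{u} A} (f : A →ₗ[A] T₀)
    (t : EndExtension A (∀ j, I j)) : (extendedEmbedding I f t).1.val = f t.s := by
  change (t • RightCarrier.mk (∀ j, I j) (f 1)).val = f t.s
  rw [RightCarrier.val_smul, RightCarrier.val_mk, ← map_smul, smul_eq_mul, mul_one]

lemma extendedEmbedding_injective {T₀ : ModuleCat.{u} A} {f : A →ₗ[A] T₀}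
    (hf : Function.Injective f) : Function.Injective (extendedEmbedding I f) := by
  intro t t' h
  ext1
  · refine MulOpposite.unop_injective (LinearMap.ext fun x => funext fun i => ?_)
    exact LinearMap.congr_fun (congrArg EvalCarrier.hom (congrFun (congrArg Prod.snd h) i)) x
  · funext i
    have := congrArg EvalCarrier.val (congrFun (congrArg Prod.snd h) i)
    exact (EvalCarrier.val_ofHom _ t).symm.trans (this.trans (EvalCarrier.val_ofHom _ t'))
  · apply hf
    rw [← extendedEmbedding_val I f, ← extendedEmbedding_val I f, h]

lemma extendedEmbedding_exact {T₀ T₁ : ModuleCat.{u} A} {f : A →ₗ[A] T₀} {g : T₀ →ₗ[A] T₁}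
    (hfg : Function.Exact f g) :
    Function.Exact (extendedEmbedding I f)
      (RightCarrier.map (∀ j, I j) g ∘ₗ LinearMap.fst _ _ (EvalSum I)) := by
  intro x
  constructor
  · intro hx
    obtain ⟨a, ha⟩ := (hfg x.1.val).1 (congrArg RightCarrier.val hx)
    -- The first column is the whole of the evaluation sum, because `Hom(E, E)` is the product of
    -- the `Hom(E, Iᵢ)`; only the entry in `A` has to be found by exactness.
    refine ⟨⟨MulOpposite.op (LinearMap.pi fun i => (x.2 i).hom), fun i => (x.2 i).val, a⟩,
      Prod.ext ?_ (funext fun i => EvalCarrier.ext ?_ ?_)⟩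
    · ext
      rw [extendedEmbedding_val, ha]
    · rfl
    · exact EvalCarrier.val_ofHom _ _
  · rintro ⟨t, rfl⟩
    ext
    change g (extendedEmbedding I f t).1.val = 0
    rw [extendedEmbedding_val]
    exact (hfg _).2 ⟨_, rfl⟩

lemma isInAdd_rightCarrier {T X : ModuleCat.{u} A} (h : IsInAdd T X) :
    IsInAdd (extendedTilting I T) (ModuleCat.of _ (RightCarrier (∀ j, I j) X)) := by
  obtain ⟨m, i, p, hpi⟩ := h
  have hT : IsInAdd (extendedTilting I T) (ModuleCat.of _ (RightCarrier (∀ j, I j) T)) :=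
    isInAdd_of_retract (LinearMap.inl _ (RightCarrier (∀ j, I j) T) (EvalSum I))
      (LinearMap.fst _ (RightCarrier (∀ j, I j) T) (EvalSum I)) rfl
  let e := RightCarrier.piEquiv (∀ j, I j) (fun _ : Fin m => T)
  refine (isInAdd_pi (X := fun _ : Fin m => ModuleCat.of _ (RightCarrier (∀ j, I j) T))
    fun _ => hT).of_retract
    (e.toLinearMap ∘ₗ RightCarrier.map (∀ j, I j) (V' := ModuleCat.of A (Fin m → T)) i)
    (RightCarrier.map (∀ j, I j) (V := ModuleCat.of A (Fin m → T)) p ∘ₗ e.symm.toLinearMap) ?_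
  refine LinearMap.ext fun x => RightCarrier.ext ?_
  exact LinearMap.congr_fun hpi x.val

variable (hinj : ∀ i, Injective (I i))
  (hproj : ∀ Q : ModuleCat.{u} A, Module.Finite A Q → Projective Q → Injective Q →
    ∀ f : (∀ i, I i) →ₗ[A] Q, f = 0)

include hinj hproj in
/-- For a finitely generated projective-injective `Q` the module
`(0, Q, 0) ⊕ ⨁ᵢ (Hom_A(E, Iᵢ), Iᵢ, ηᵢ)` is finitely generated and projective-injective. -/
lemma extended_projInj (Q : ModuleCat.{u} A) [Module.Finite A Q] [Module.Projective A Q]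
    [Module.Injective A Q] :
    Module.Finite (EndExtension A (∀ j, I j)) (extendedTilting I Q) ∧
      Module.Projective (EndExtension A (∀ j, I j)) (extendedTilting I Q) ∧
      Module.Injective (EndExtension A (∀ j, I j)) (extendedTilting I Q) := by
  have h0 := hproj Q ‹_› ((projective_object_iff Q).2 ‹_›) ((injective_object_iff Q).2 ‹_›)
  let e := EvalCarrier.rightEquiv h0
  have := evalSum_finite I
  have := evalSum_projective I
  have := evalSum_injective I hinj
  have := RightCarrier.finite (E := ∀ j, I j) (V := Q)
  have := RightCarrier.projective (E := ∀ j, I j) (V := Q)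
  have := EvalCarrier.injective (E := ∀ j, I j) (V := Q)
  have := injective_of_retract e.toLinearMap e.symm.toLinearMap (by ext; rfl)
  exact ⟨inferInstanceAs (Module.Finite _ (RightCarrier (∀ j, I j) Q × EvalSum I)),
    inferInstanceAs (Module.Projective _ (RightCarrier (∀ j, I j) Q × EvalSum I)),
    injective_prod (RightCarrier (∀ j, I j) Q) (EvalSum I)⟩

-- Apply `V ↦ (0, V, 0)` to the maps `Qᵐ → T → Qⁿ` that witness membership in `C_A`, and add the
-- identity of the evaluation sum. The outer modules become projective-injective, which gives
-- membership in `C_{A[E]}` and, with the projective dimension bound, rigidity.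
include hinj hproj in
theorem extendedTilting_isTilting_isInC [IsArtinianRing (EndExtension A (∀ j, I j))]
    (hind : ∀ i, Indecomposable (I i)) (hne : ∀ i j, Nonempty (I i ≃ₗ[A] I j) → i = j)
    {T : ModuleCat.{u} A} (hT : IsTilting T) (hC : IsInC T) :
    IsTilting (extendedTilting I T) ∧ IsInC (extendedTilting I T) := by
  obtain ⟨hfin, Q, hQ, ⟨m, f, hf⟩, ⟨n, g, hg⟩⟩ := hC
  obtain ⟨_, _, _⟩ := hQ.properties
  let P := ModuleCat.of A (Fin m → Q)
  let P' := ModuleCat.of A (Fin n → Q)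
  have : Module.Projective A P := projective_pi fun _ : Fin m => (Q : Type u)
  have : Module.Projective A P' := projective_pi fun _ : Fin n => (Q : Type u)
  have : Module.Finite A P := inferInstanceAs (Module.Finite A (Fin m → Q))
  have : Module.Finite A P' := inferInstanceAs (Module.Finite A (Fin n → Q))
  have : Module.Injective A P := inferInstanceAs (Module.Injective A (Fin m → Q))
  have : Module.Injective A P' := inferInstanceAs (Module.Injective A (Fin n → Q))
  obtain ⟨_, _, _⟩ := extended_projInj I hinj hproj P
  obtain ⟨_, _, _⟩ := extended_projInj I hinj hproj P'
  let F : extendedTilting I P →ₗ[EndExtension A (∀ j, I j)] extendedTilting I T :=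
    (RightCarrier.map (∀ j, I j) f).prodMap (LinearMap.id (M := EvalSum I))
  have hF : Function.Surjective F :=
    (RightCarrier.map_surjective hf).prodMap Function.surjective_id
  let G : extendedTilting I T →ₗ[EndExtension A (∀ j, I j)] extendedTilting I P' :=
    (RightCarrier.map (∀ j, I j) g).prodMap (LinearMap.id (M := EvalSum I))
  have hG : Function.Injective G :=
    (RightCarrier.map_injective (V' := P') hg).prodMap Function.injective_id
  have hpd : HasProjectiveDimensionLE (extendedTilting I T) 1 :=
    hasProjectiveDimensionLE_one_prod
      (X := ModuleCat.of _ (RightCarrier (∀ j, I j) T)) (Y := ModuleCat.of _ (EvalSum I))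
      (RightCarrier.hasProjectiveDimensionLE_one hT.pd_le_one)
      (hasProjectiveDimensionLE_one_of_projective
        ((projective_object_iff _).2 (evalSum_projective I)))
  refine ⟨⟨Module.Finite.of_surjective F hF, extendedTilting_isBasicModule I hind hne hT.basic,
    hpd, subsingleton_ext_one_of_injective_surjective hpd F hF, ?_⟩,
    isInC_of_surjective_of_injective _ _ F hF G hG⟩
  obtain ⟨T₀, T₁, a, b, h₀, h₁, ha, hab, hb⟩ := hT.coresolution
  refine ⟨ModuleCat.of _ (RightCarrier (∀ j, I j) T₀ × EvalSum I),
    ModuleCat.of _ (RightCarrier (∀ j, I j) T₁), extendedEmbedding I a,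
    RightCarrier.map (∀ j, I j) b ∘ₗ LinearMap.fst _ _ (EvalSum I), ?_, isInAdd_rightCarrier I h₁,
    extendedEmbedding_injective I ha, extendedEmbedding_exact I hab,
    (RightCarrier.map_surjective hb).comp Prod.fst_surjective⟩
  exact isInAdd_prod (X := ModuleCat.of _ (RightCarrier (∀ j, I j) T₀))
    (Y := ModuleCat.of _ (EvalSum I)) (isInAdd_rightCarrier I h₀)
    (isInAdd_of_retract (LinearMap.inr _ (RightCarrier (∀ j, I j) T) (EvalSum I))
      (LinearMap.snd _ (RightCarrier (∀ j, I j) T) (EvalSum I)) rfl)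

lemma restrict_single_bijective (horth : ∀ i j, i ≠ j → ∀ f : I i →ₗ[A] I j, f = 0) (i : Fin r) :
    Function.Bijective
      (fun f : (∀ j, I j) →ₗ[A] I i => f ∘ₗ LinearMap.single A (fun j => I j) i) := by
  refine ⟨fun f g h => LinearMap.pi_ext' fun j => ?_, fun g => ⟨g ∘ₗ LinearMap.proj i, ?_⟩⟩
  · rcases eq_or_ne j i with rfl | hj
    · exact h
    · rw [horth j i hj (f ∘ₗ _), horth j i hj (g ∘ₗ _)]
  · ext x
    simp

end ExtendedTilting

end

theorem mainTheorem9
    {k : Type*} [CommRing k] [IsArtinianRing k]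
    {A : Type u} [Ring A] [Algebra k A] [Module.Finite k A]
    (hA : IsAuslander A)
    {r : ℕ} (I : Fin r → ModuleCat.{u} A)
    (hfin : ∀ i, Module.Finite A (I i))
    (hind : ∀ i, Indecomposable (I i))
    (hinj : ∀ i, Injective (I i))
    (hdiv : ∀ i, ∀ f : Module.End A (I i), f ≠ 0 → IsUnit f)
    (horth : ∀ i j, i ≠ j → ∀ f : I i →ₗ[A] I j, f = 0)
    (hproj : ∀ Q : ModuleCat.{u} A, Module.Finite A Q → Projective Q → Injective Q →
      ∀ f : (∀ i, I i) →ₗ[A] Q, f = 0) :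
    (∃ M : ModuleCat.{u} (EndExtension A (∀ i, I i)), IsTilting M ∧ IsInC M) ∧
    (∃ T : ModuleCat.{u} A, IsTilting T ∧ IsInC T) ∧
    (∀ T : ModuleCat.{u} A, IsTilting T → IsInC T →
      IsTilting (extendedTilting I T) ∧ IsInC (extendedTilting I T)) ∧
    (∀ i, Function.Bijective
        (fun f : (∀ j, I j) →ₗ[A] I i => f ∘ₗ LinearMap.single A (fun j => I j) i) ∧
      Function.Bijective (evalEta (∀ j, I j) (I i))) := by
  have : IsArtinianRing A := isArtinian_of_tower k inferInstance
  have : IsArtinianRing (EndExtension A (∀ i, I i)) := isArtinianRing_endExtension k _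
  -- Orthogonality already forces the nonzero modules `I i` to be pairwise non-isomorphic, as
  -- basicness requires.
  have hne : ∀ i j, Nonempty (I i ≃ₗ[A] I j) → i = j := by
    rintro i j ⟨e⟩
    by_contra hij
    have := (hind i).nontrivial_module
    obtain ⟨x, hx⟩ := exists_ne (0 : I i)
    exact hx (e.map_eq_zero_iff.1 (LinearMap.congr_fun (horth i j hij e.toLinearMap) x))
  have key := fun T : ModuleCat.{u} A =>
    extendedTilting_isTilting_isInC I hinj hproj hind hne (T := T)
  obtain ⟨T, hT, hC⟩ := hA.exists_isTilting_isInC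
  exact ⟨⟨extendedTilting I T, key T hT hC⟩, ⟨T, hT, hC⟩, key, fun i =>
    ⟨restrict_single_bijective I horth i, evalEta_bijective (proj_comp_single_eq_id I i)⟩⟩
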